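/- Let $N\ge 2$ be an integer, let $\mathbb Z^+=\{0,1,2,\dots\}$ and let $e_0,e_1,\dots$ be the standard basis of $\ell^2(\mathbb Z^+)$. For $0\le i<N$ let $S_i$ be the isometry of $\ell^2(\mathbb Z^+)$ given by $(S_i x)_k=x_r$ if $k=rN+i$, and $(S_i x)_k=0$ if $k\not\equiv i \pmod N$. Let $\mathcal O_N\subseteq L(\ell^2(\mathbb Z^+))$ be the (concrete) Cuntz algebra, i.e. the smallest $C^*$-subalgebra containing $S_0,\dots,S_{N-1}$, and let $P_n$ be the orthogonal projection onto $\operatorname{span}\{e_0,\dots,e_{n-1}\}$. Let $\mathcal F$ be the $C^*$-algebra of all bounded sequences $(A_n)_{n\ge 1}$ of matrices $A_n\in\mathbb C^{n\times n}$ (entrywise operations, supremum of the operator norms), and let $\mathcal S(\mathcal O_N)$ be the smallest $C^*$-subalgebra of $\mathcal F$ containing all sequences $(P_nAP_n)_{n\ge1}$ with $A\in\mathcal O_N$, where $P_nAP_n$ is identified with its $n\times n$ matrix with respect to $e_0,\dots,e_{n-1}$. Put $\eta(n)=N^n$ for $n\ge 0$, let $\mathcal F_\eta$ be the $C^*$-algebra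 of all bounded sequences $(A_{\eta(n)})_{n\ge 0}$ of $\eta(n)\times\eta(n)$ matrices, let $\mathcal S_\eta(\mathcal O_N)\subseteq\mathcal F_\eta$ be the set of the subsequences $(A_{\eta(n)})_{n\ge0}$ of the sequences $(A_n)\in\mathcal S(\mathcal O_N)$, and let $\mathcal G_\eta\subseteq\mathcal F_\eta$ be the ideal of the sequences with $\|A_{\eta(n)}\|\to 0$. Let $$\mathcal S_N:=\mathcal S_\eta(\mathcal O_N)/\mathcal G_\eta\subseteq\mathcal F_\eta/\mathcal G_\eta ,$$ with identity element $e$, let $s_0:=(P_{N^n}S_0P_{N^n})_{n\ge 0}+\mathcal G_\eta$ and $p_1:=s_0^*s_0$, and let $\mathcal J_N$ be the smallest closed two-sided ideal of $\mathcal S_N$ that contains $e-p_1$. Then: 1. Every proper closed two-sided ideal of $\mathcal S_N$ is contained in $\mathcal J_N$. 2. Every $*$-homomorphism (not necessarily unital) from $\mathcal S_N$ into a $C^*$-algebra that is injective on $\mathcal J_N$ is injective on all of $\mathcal S_N$. -/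

import Mathlib

open scoped ENNReal Topology Matrix.Norms.L2Operator
open Filter

noncomputable section

namespace CuntzSections

/-! ### The isometries `S_i` on `ℓ²(ℤ⁺)` and the concrete Cuntz algebra -/

/-- The Hilbert space `ℓ²(ℤ⁺)`, with `ℤ⁺ = {0, 1, 2, …}`. -/
abbrev Hilb : Type := lp (fun _ : ℕ => ℂ) 2

/-- The standard basis vector `e_k` of `ℓ²(ℤ⁺)`. -/
def basisVec (k : ℕ) : Hilb := lp.single 2 k 1

/-- The sequence `(y_k)` with `y_k = x_r` if `k = r N + i`, and `y_k = 0` otherwise. -/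
def spread (N : ℕ) (i : Fin N) (x : ℕ → ℂ) (k : ℕ) : ℂ :=
  if k % N = i then x (k / N) else 0

theorem spread_apply_self (N : ℕ) (i : Fin N) (x : ℕ → ℂ) (r : ℕ) :
    spread N i x (r * N + i) = x r := by
  have hN : 0 < N := i.pos
  have h1 : (r * N + i) % N = i := by
    rw [mul_comm, Nat.mul_add_mod, Nat.mod_eq_of_lt i.isLt]
  have h2 : (r * N + i) / N = r := by
    rw [mul_comm, Nat.mul_add_div hN, Nat.div_eq_of_lt i.isLt, add_zero]
  simp [spread, h1, h2]

theorem spread_injective_index (N : ℕ) (i : Fin N) :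
    Function.Injective (fun r : ℕ => r * N + (i : ℕ)) := by
  intro a b h
  exact Nat.eq_of_mul_eq_mul_right i.pos (Nat.add_right_cancel h)

theorem spread_eq_zero (N : ℕ) (i : Fin N) (x : ℕ → ℂ) (k : ℕ)
    (hk : k ∉ Set.range (fun r : ℕ => r * N + (i : ℕ))) : spread N i x k = 0 := by
  unfold spread
  split_ifs with h
  · exact absurd ⟨k / N, by simp only [← h]; exact Nat.div_add_mod' k N⟩ hk
  · rfl

theorem hasSum_spread (N : ℕ) (i : Fin N) (x : Hilb) :
    HasSum (fun k => ‖spread N i x k‖ ^ (2 : ℝ≥0∞).toReal) (‖x‖ ^ (2 : ℝ≥0∞).toReal) := by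
  rw [← (spread_injective_index N i).hasSum_iff]
  · have h := lp.hasSum_norm (p := 2) (by norm_num) x
    convert h using 2 with r
    simp only [Function.comp_apply, spread_apply_self]
  · intro k hk
    rw [spread_eq_zero N i x k hk]
    simp

/-- The operator `S_i` on `ℓ²(ℤ⁺)`, `(x_k) ↦ (y_k)` with `y_k = x_r` if `k = r N + i`
and `y_k = 0` otherwise. It is an isometry. -/
def cuntzIsometry (N : ℕ) (i : Fin N) : Hilb →ₗᵢ[ℂ] Hilb where
  toFun x := ⟨spread N i x, memℓp_gen (hasSum_spread N i x).summable⟩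
  map_add' x y := by
    ext k
    simp only [spread, lp.coeFn_add, Pi.add_apply]
    split_ifs <;> simp
  map_smul' c x := by
    ext k
    simp only [spread, lp.coeFn_smul, Pi.smul_apply, RingHom.id_apply, smul_eq_mul]
    split_ifs <;> simp
  norm_map' x := by
    have h1 := lp.norm_rpow_eq_tsum (p := 2) (by norm_num)
      (⟨spread N i x, memℓp_gen (hasSum_spread N i x).summable⟩ : Hilb)
    have h2 := h1.trans (hasSum_spread N i x).tsum_eq
    exact (Real.rpow_left_inj (norm_nonneg _) (norm_nonneg _) (by norm_num)).1 h2

/-- `S_i` as a bounded operator. -/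
def cuntzS (N : ℕ) (i : Fin N) : Hilb →L[ℂ] Hilb := (cuntzIsometry N i).toContinuousLinearMap

/-- The concrete Cuntz algebra `O_N`: the smallest C⋆-subalgebra of `L(ℓ²(ℤ⁺))` that contains
`S_0, …, S_{N-1}`. -/
def cuntzAlgebra (N : ℕ) : StarSubalgebra ℂ (Hilb →L[ℂ] Hilb) :=
  (StarAlgebra.adjoin ℂ (Set.range (cuntzS N))).topologicalClosure

/-! ### Algebras of matrix sequences -/

/-- The C⋆-algebra of `n × n` matrices with the operator norm for the Euclidean norm on `ℂⁿ`. -/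
abbrev Mat (n : ℕ+) : Type := Matrix (Fin n) (Fin n) ℂ

/-- The C⋆-algebra `F` of all bounded sequences `(A_n)`, `n ≥ 1`, of `n × n` matrices, with
entrywise operations and the supremum norm. -/
abbrev SeqAlg : Type := lp (fun n : ℕ+ => Mat n) ∞

/-- The C⋆-algebra `F_η` of all bounded sequences `(A_{η(n)})` of `η(n) × η(n)` matrices. -/
abbrev SubseqAlg (η : ℕ → ℕ+) : Type := lp (fun n : ℕ => Mat (η n)) ∞

/-- The restriction `R_η : F → F_η`, `(A_n) ↦ (A_{η(n)})`. -/
def restrict (η : ℕ → ℕ+) : SeqAlg →⋆ₐ[ℂ] SubseqAlg η where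
  toFun A := ⟨fun n => A (η n), memℓp_infty
    ⟨‖A‖, by rintro _ ⟨n, rfl⟩; exact lp.norm_apply_le_norm ENNReal.top_ne_zero A (η n)⟩⟩
  map_one' := rfl
  map_mul' _ _ := rfl
  map_zero' := rfl
  map_add' _ _ := rfl
  commutes' _ := rfl
  map_star' _ := rfl

/-- The matrix of `P_n A P_n : im P_n → im P_n` with respect to the basis `e_0, …, e_{n-1}`. -/
def finiteSection (A : Hilb →L[ℂ] Hilb) (n : ℕ+) : Mat n :=
  Matrix.of fun j k => A (basisVec k) (j : ℕ)

theorem norm_finiteSection_le (A : Hilb →L[ℂ] Hilb) (n : ℕ+) : ‖finiteSection A n‖ ≤ ‖A‖ := by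
  rw [Matrix.cstar_norm_def]
  refine ContinuousLinearMap.opNorm_le_bound _ (norm_nonneg _) fun x => ?_
  let w : ℕ → ℂ := fun k => if h : k < n then x ⟨k, h⟩ else 0
  let v : Hilb := ∑ k ∈ Finset.range n, lp.single 2 k (w k)
  have hw : ∀ k : Fin n, w k = x k := fun k => by simp [w]
  have hv : ‖v‖ = ‖x‖ := by
    have h := lp.norm_sum_single (p := 2) (by norm_num) w (Finset.range n)
    rw [← Real.rpow_left_inj (norm_nonneg _) (norm_nonneg _) (by norm_num : (2 : ℝ) ≠ 0)]
    simp only [ENNReal.toReal_ofNat] at h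
    rw [h, Finset.sum_range]
    simp only [hw, Real.rpow_two, EuclideanSpace.norm_sq_eq]
  have hx : ∀ j : Fin n,
      Matrix.toEuclideanCLM (n := Fin n) (𝕜 := ℂ) (finiteSection A n) x j = A v (j : ℕ) := by
    intro j
    have hs : ∀ k : ℕ, lp.single 2 k (w k) = w k • basisVec k := fun k => by
      rw [basisVec, ← lp.single_smul]; simp
    have hAv : A v = ∑ k ∈ Finset.range n, w k • A (basisVec k) := by
      simp only [v, hs, map_sum, map_smul]
    rw [hAv, lp.coeFn_sum, Finset.sum_apply, Finset.sum_range, Matrix.ofLp_toEuclideanCLM]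
    simp only [Matrix.mulVec, dotProduct, finiteSection, Matrix.of_apply, lp.coeFn_smul,
      Pi.smul_apply, smul_eq_mul, hw, mul_comm]
  have hle : ‖Matrix.toEuclideanCLM (n := Fin n) (𝕜 := ℂ) (finiteSection A n) x‖ ≤ ‖A v‖ := by
    have h := lp.sum_rpow_le_norm_rpow (p := 2) (by norm_num) (A v) (Finset.range n)
    rw [← Real.rpow_le_rpow_iff (norm_nonneg _) (norm_nonneg _) (by norm_num : (0 : ℝ) < 2)]
    simp only [ENNReal.toReal_ofNat] at h
    refine le_trans (le_of_eq ?_) h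
    rw [Real.rpow_two, EuclideanSpace.norm_sq_eq, Finset.sum_range]
    simp only [hx, Real.rpow_two]
  rw [← hv]
  exact hle.trans (A.le_opNorm v)

/-- The finite sections discretization `D : L(ℓ²(ℤ⁺)) → F`, `A ↦ (P_n A P_n)`. -/
def discretize (A : Hilb →L[ℂ] Hilb) : SeqAlg :=
  ⟨finiteSection A, memℓp_infty ⟨‖A‖, by rintro _ ⟨n, rfl⟩; exact norm_finiteSection_le A n⟩⟩

/-- The algebra `S(𝒜)` of the finite sections method: the smallest C⋆-subalgebra of `F` that
contains all sequences `(P_n A P_n)` with `A ∈ 𝒜`. -/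
def sectionsAlgebra (𝒜 : StarSubalgebra ℂ (Hilb →L[ℂ] Hilb)) : StarSubalgebra ℂ SeqAlg :=
  (StarAlgebra.adjoin ℂ (discretize '' (𝒜 : Set (Hilb →L[ℂ] Hilb)))).topologicalClosure

/-- The restricted algebra `S_η(𝒜) = R_η(S(𝒜))`. -/
def restrictedAlgebra (η : ℕ → ℕ+) (𝒜 : StarSubalgebra ℂ (Hilb →L[ℂ] Hilb)) :
    StarSubalgebra ℂ (SubseqAlg η) :=
  (sectionsAlgebra 𝒜).map (restrict η)

/-! ### The quotient C⋆-algebra `F_η / G_η` -/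

/-- The ideal `G_η` of the sequences in `F_η` that tend to zero in the norm. -/
def nullIdeal (η : ℕ → ℕ+) : Ideal (SubseqAlg η) where
  carrier := {A | Tendsto (fun n => ‖A n‖) atTop (𝓝 0)}
  zero_mem' := by simp
  add_mem' {A B} hA hB := by
    refine squeeze_zero (fun n => norm_nonneg _) (fun n => norm_add_le (A n) (B n)) ?_
    simpa using Tendsto.add hA hB
  smul_mem' C A hA := by
    refine squeeze_zero (fun n => norm_nonneg _) (fun n => (norm_mul_le (C n) (A n)).trans
      (mul_le_mul_of_nonneg_right (lp.norm_apply_le_norm ENNReal.top_ne_zero C n)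
        (norm_nonneg _))) ?_
    simpa using Tendsto.const_mul ‖C‖ hA

theorem mem_nullIdeal {η : ℕ → ℕ+} {A : SubseqAlg η} :
    A ∈ nullIdeal η ↔ Tendsto (fun n => ‖A n‖) atTop (𝓝 0) := Iff.rfl

instance nullIdeal_isTwoSided (η : ℕ → ℕ+) : (nullIdeal η).IsTwoSided where
  mul_mem_of_left {A} C hA := by
    refine squeeze_zero (fun n => norm_nonneg _) (fun n => (norm_mul_le (A n) (C n)).trans
      (mul_le_mul_of_nonneg_left (lp.norm_apply_le_norm ENNReal.top_ne_zero C n)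
        (norm_nonneg _))) ?_
    simpa using Tendsto.mul_const ‖C‖ hA

theorem star_mem_nullIdeal {η : ℕ → ℕ+} {A : SubseqAlg η} (hA : A ∈ nullIdeal η) :
    star A ∈ nullIdeal η := by
  rw [mem_nullIdeal] at hA ⊢
  simpa using hA

instance nullIdeal_isClosed (η : ℕ → ℕ+) : IsClosed (nullIdeal η : Set (SubseqAlg η)) := by
  refine isClosed_of_closure_subset fun A hA => ?_
  change Tendsto (fun n => ‖A n‖) atTop (𝓝 0)
  rw [Metric.mem_closure_iff] at hA
  rw [Metric.tendsto_atTop]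
  intro ε hε
  obtain ⟨B, hB, hAB⟩ := hA (ε / 2) (half_pos hε)
  obtain ⟨m, hm⟩ := Metric.tendsto_atTop.1 (mem_nullIdeal.1 hB) (ε / 2) (half_pos hε)
  refine ⟨m, fun n hn => ?_⟩
  have h1 : ‖A n - B n‖ ≤ ‖A - B‖ := lp.norm_apply_le_norm ENNReal.top_ne_zero (A - B) n
  have h2 := hm n hn
  have h3 : ‖A n‖ ≤ ‖A n - B n‖ + ‖B n‖ := by
    simpa using norm_add_le (A n - B n) (B n)
  rw [dist_eq_norm] at hAB
  simp only [dist_zero_right, norm_norm] at h2 ⊢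
  linarith

/-- The quotient algebra `F_η / G_η`. -/
def QuotAlg (η : ℕ → ℕ+) : Type := SubseqAlg η ⧸ nullIdeal η

/-- The algebraic operations on cosets. -/
instance (η : ℕ → ℕ+) : Ring (QuotAlg η) :=
  inferInstanceAs (Ring (SubseqAlg η ⧸ nullIdeal η))

set_option synthInstance.maxHeartbeats 200000 in
instance (η : ℕ → ℕ+) : Algebra ℂ (QuotAlg η) :=
  inferInstanceAs (Algebra ℂ (SubseqAlg η ⧸ nullIdeal η))

/-- The coset map `F_η → F_η / G_η` as an algebra homomorphism. -/
def coset (η : ℕ → ℕ+) : SubseqAlg η →ₐ[ℂ] QuotAlg η := Ideal.Quotient.mkₐ ℂ (nullIdeal η)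

theorem coset_surjective (η : ℕ → ℕ+) : Function.Surjective (coset η) :=
  Ideal.Quotient.mk_surjective

theorem coset_eq_zero_iff {η : ℕ → ℕ+} {A : SubseqAlg η} : coset η A = 0 ↔ A ∈ nullIdeal η :=
  Ideal.Quotient.eq_zero_iff_mem

theorem coset_eq_coset_iff {η : ℕ → ℕ+} {A B : SubseqAlg η} :
    coset η A = coset η B ↔ A - B ∈ nullIdeal η :=
  Ideal.Quotient.mk_eq_mk_iff_sub_mem A B

/-- The involution `(A + G_η)* = A* + G_η`. -/
instance (η : ℕ → ℕ+) : Star (QuotAlg η) where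
  star := Quotient.lift (fun A : SubseqAlg η => coset η (star A)) fun A B h => by
    rw [coset_eq_coset_iff, ← star_sub]
    exact star_mem_nullIdeal ((Submodule.quotientRel_def _).1 h)

theorem star_coset {η : ℕ → ℕ+} (A : SubseqAlg η) : star (coset η A) = coset η (star A) := rfl

instance (η : ℕ → ℕ+) : StarRing (QuotAlg η) where
  star_involutive a := by
    obtain ⟨A, rfl⟩ := coset_surjective η a
    simp only [star_coset, star_star]
  star_mul a b := by
    obtain ⟨A, rfl⟩ := coset_surjective η a
    obtain ⟨B, rfl⟩ := coset_surjective η b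
    rw [← map_mul, star_coset, star_coset, star_coset, ← map_mul]
    exact congrArg (coset η) (star_mul A B)
  star_add a b := by
    obtain ⟨A, rfl⟩ := coset_surjective η a
    obtain ⟨B, rfl⟩ := coset_surjective η b
    simp only [star_coset, ← map_add, star_add]

instance (η : ℕ → ℕ+) : StarModule ℂ (QuotAlg η) where
  star_smul c a := by
    obtain ⟨A, rfl⟩ := coset_surjective η a
    simp only [star_coset, ← map_smul, star_smul]

/-- The quotient norm `‖a‖ = inf {‖A‖ : A + G_η = a}`. -/
instance (η : ℕ → ℕ+) : NormedAddCommGroup (QuotAlg η) :=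
  inferInstanceAs (NormedAddCommGroup (SubseqAlg η ⧸ nullIdeal η))

theorem norm_coset_le {η : ℕ → ℕ+} (A : SubseqAlg η) : ‖coset η A‖ ≤ ‖A‖ :=
  Submodule.Quotient.norm_mk_le (nullIdeal η) A

theorem exists_coset_norm_lt {η : ℕ → ℕ+} (a : QuotAlg η) {ε : ℝ} (hε : 0 < ε) :
    ∃ A : SubseqAlg η, coset η A = a ∧ ‖A‖ < ‖a‖ + ε :=
  Submodule.Quotient.norm_mk_lt (S := nullIdeal η) a hε

theorem norm_quot_mul_le {η : ℕ → ℕ+} (a b : QuotAlg η) : ‖a * b‖ ≤ ‖a‖ * ‖b‖ := by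
  have key : ∀ ε > (0 : ℝ), ‖a * b‖ ≤ (‖a‖ + ε) * (‖b‖ + ε) := by
    intro ε hε
    obtain ⟨A, rfl, hA⟩ := exists_coset_norm_lt a hε
    obtain ⟨B, rfl, hB⟩ := exists_coset_norm_lt b hε
    rw [← map_mul]
    exact (norm_coset_le _).trans ((norm_mul_le A B).trans
      (mul_le_mul hA.le hB.le (norm_nonneg _) (by positivity)))
  have hlim : Tendsto (fun ε : ℝ => (‖a‖ + ε) * (‖b‖ + ε)) (𝓝[>] 0) (𝓝 (‖a‖ * ‖b‖)) := by
    have hc : Continuous (fun ε : ℝ => (‖a‖ + ε) * (‖b‖ + ε)) := by fun_prop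
    simpa using (hc.tendsto 0).mono_left nhdsWithin_le_nhds
  exact ge_of_tendsto hlim (eventually_nhdsWithin_of_forall key)

theorem norm_quot_smul_le {η : ℕ → ℕ+} (c : ℂ) (a : QuotAlg η) : ‖c • a‖ ≤ ‖c‖ * ‖a‖ := by
  have key : ∀ ε > (0 : ℝ), ‖c • a‖ ≤ ‖c‖ * (‖a‖ + ε) := by
    intro ε hε
    obtain ⟨A, rfl, hA⟩ := exists_coset_norm_lt a hε
    rw [← map_smul]
    exact (norm_coset_le _).trans ((norm_smul_le c A).trans
      (mul_le_mul_of_nonneg_left hA.le (norm_nonneg _)))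
  have hlim : Tendsto (fun ε : ℝ => ‖c‖ * (‖a‖ + ε)) (𝓝[>] 0) (𝓝 (‖c‖ * ‖a‖)) := by
    have hc : Continuous (fun ε : ℝ => ‖c‖ * (‖a‖ + ε)) := by fun_prop
    simpa using (hc.tendsto 0).mono_left nhdsWithin_le_nhds
  exact ge_of_tendsto hlim (eventually_nhdsWithin_of_forall key)

/-- If the entries of `A` are eventually bounded by `r`, then `‖A + G_η‖ ≤ r`. -/
theorem norm_coset_le_of_eventually {η : ℕ → ℕ+} (A : SubseqAlg η) {r : ℝ} (hr : 0 ≤ r)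
    (m : ℕ) (h : ∀ n ≥ m, ‖A n‖ ≤ r) : ‖coset η A‖ ≤ r := by
  let B : SubseqAlg η := ⟨fun n => if m ≤ n then A n else 0, memℓp_infty ⟨r, by
    rintro _ ⟨n, rfl⟩
    dsimp only
    split_ifs with hn
    · exact h n hn
    · simpa using hr⟩⟩
  have hB : ∀ n, B n = if m ≤ n then A n else 0 := fun _ => rfl
  have hAB : coset η A = coset η B := by
    rw [coset_eq_coset_iff, mem_nullIdeal]
    refine tendsto_const_nhds.congr' ?_
    filter_upwards [eventually_ge_atTop m] with n hn
    rw [lp.coeFn_sub, Pi.sub_apply, hB, if_pos hn, sub_self, norm_zero]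
  rw [hAB]
  refine (norm_coset_le B).trans (lp.norm_le_of_forall_le hr fun n => ?_)
  rw [hB]
  split_ifs with hn
  · exact h n hn
  · simpa using hr

theorem norm_quot_mul_self_le {η : ℕ → ℕ+} (a : QuotAlg η) : ‖a‖ * ‖a‖ ≤ ‖star a * a‖ := by
  obtain ⟨A, rfl⟩ := coset_surjective η a
  rw [star_coset, ← map_mul]
  refine le_of_forall_pos_le_add fun ε hε => ?_
  obtain ⟨B, hB, hBn⟩ := exists_coset_norm_lt (coset η (star A * A)) (half_pos hε)
  rw [eq_comm, coset_eq_coset_iff, mem_nullIdeal] at hB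
  obtain ⟨m, hm⟩ := Metric.tendsto_atTop.1 hB (ε / 2) (half_pos hε)
  set t : ℝ := ‖coset η (star A * A)‖ + ε with ht
  have ht0 : 0 ≤ t := by positivity
  have hle : ‖coset η A‖ ≤ √t := by
    refine norm_coset_le_of_eventually A (Real.sqrt_nonneg _) m fun n hn => ?_
    refine Real.le_sqrt_of_sq_le ?_
    have h1 : ‖A n‖ ^ 2 = ‖(star A * A) n‖ := by
      rw [sq, ← CStarRing.norm_star_mul_self]
      rfl
    have h2 : ‖(star A * A) n‖ ≤ ‖(star A * A - B) n‖ + ‖B n‖ := by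
      have h := norm_add_le ((star A * A - B) n) (B n)
      rwa [lp.coeFn_sub, Pi.sub_apply, sub_add_cancel] at h
    have h3 := hm n hn
    have h4 : ‖B n‖ ≤ ‖B‖ := lp.norm_apply_le_norm ENNReal.top_ne_zero B n
    simp only [dist_zero_right, norm_norm] at h3
    rw [h1]
    linarith
  calc ‖coset η A‖ * ‖coset η A‖ ≤ √t * √t :=
        mul_le_mul hle hle (norm_nonneg _) (Real.sqrt_nonneg _)
    _ = t := Real.mul_self_sqrt ht0

instance (η : ℕ → ℕ+) : NormedRing (QuotAlg η) where
  __ := instRingQuotAlg η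
  __ := instNormedAddCommGroupQuotAlg η
  norm_mul_le := norm_quot_mul_le

instance (η : ℕ → ℕ+) : NormedAlgebra ℂ (QuotAlg η) where
  __ := instAlgebraComplexQuotAlg η
  norm_smul_le := norm_quot_smul_le

instance (η : ℕ → ℕ+) : CStarRing (QuotAlg η) where
  norm_mul_self_le := norm_quot_mul_self_le

instance (η : ℕ → ℕ+) : CompleteSpace (QuotAlg η) :=
  Submodule.Quotient.completeSpace (nullIdeal η)

/-- The C⋆-algebra structure of `F_η / G_η`. -/
instance (η : ℕ → ℕ+) : CStarAlgebra (QuotAlg η) where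

/-- The quotient map `F_η → F_η / G_η`. -/
def toQuot (η : ℕ → ℕ+) : SubseqAlg η →⋆ₐ[ℂ] QuotAlg η where
  __ := coset η
  map_star' _ := rfl

/-! ### The algebra `S_N` and the ideal `J_N` -/

/-- The sequence `η(n) = N ^ n`. -/
def powSeq (N : ℕ) [NeZero N] (n : ℕ) : ℕ+ := ⟨N ^ n, pow_pos (NeZero.pos N) n⟩

/-- The algebra `S_N = S_η(O_N) / G_η` with `η(n) = N ^ n`, as the algebra of all cosets
`A + G_η` in `F_η / G_η` with `A ∈ S_η(O_N)`. -/
def finiteSectionsAlgebra (N : ℕ) [NeZero N] : StarSubalgebra ℂ (QuotAlg (powSeq N)) :=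
  (restrictedAlgebra (powSeq N) (cuntzAlgebra N)).map (toQuot (powSeq N))

theorem cuntzS_mem (N : ℕ) (i : Fin N) : cuntzS N i ∈ cuntzAlgebra N :=
  StarSubalgebra.le_topologicalClosure _ (StarAlgebra.subset_adjoin ℂ _ (Set.mem_range_self i))

theorem discretize_mem {𝒜 : StarSubalgebra ℂ (Hilb →L[ℂ] Hilb)} {A : Hilb →L[ℂ] Hilb}
    (hA : A ∈ 𝒜) : discretize A ∈ sectionsAlgebra 𝒜 :=
  StarSubalgebra.le_topologicalClosure _
    (StarAlgebra.subset_adjoin ℂ _ (Set.mem_image_of_mem _ hA))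

/-- The element `s_i = (P_{N^n} S_i P_{N^n})_{n ≥ 0} + G_η` of `S_N`. -/
def partialIsom (N : ℕ) [NeZero N] (i : Fin N) : finiteSectionsAlgebra N :=
  ⟨toQuot (powSeq N) (restrict (powSeq N) (discretize (cuntzS N i))),
    ⟨_, ⟨_, discretize_mem (cuntzS_mem N i), rfl⟩, rfl⟩⟩

/-- The projection `p_1 = s_0* s_0`, the joint initial projection of `s_0, …, s_{N-1}`. -/
def initialProj (N : ℕ) [NeZero N] : finiteSectionsAlgebra N :=
  star (partialIsom N 0) * partialIsom N 0

/-- The ideal `J_N`: the smallest closed two-sided ideal of `S_N` that contains `e - p_1`. -/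
def idealJ (N : ℕ) [NeZero N] : Ideal (finiteSectionsAlgebra N) :=
  sInf {I : Ideal (finiteSectionsAlgebra N) | I.IsTwoSided ∧
    IsClosed (I : Set (finiteSectionsAlgebra N)) ∧ (1 : finiteSectionsAlgebra N) - initialProj N ∈ I}

end CuntzSections

end

/-! Let `p_k` be the coset of the projections `P_{N^(n-k)}`. Since `S_i e_r = e_(rN+i)`, one has
`s_i p_(k+1) = p_k s_i`, so the truncation of `S_i` is felt only near the upper end of the matrices
and is invisible behind `p_1`. Let `K` (`levelNull`) be the closed left ideal of all `x` with `x p_k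
→ 0`. Compression `A ↦ (P A P) + G` is multiplicative modulo `K` on the Cuntz algebra, and `‖A‖ ≤
‖compress A + x‖` for `x ∈ K`. Hence every element of `S_N` is a compression of some `A ∈ O_N` plus
an element of `K` (`finiteSectionsAlgebra_le_compressions`). Moreover `K ∩ S_N ⊆ J_N`, because `x =
lim x (1 - p_k)` and `1 - p_k ∈ J_N`.

Now let `I` be a closed ideal with an element `x` outside `J_N`. Its operator part `A` is nonzero,
and simplicity of `O_N` (`exists_norm_mul_mul_sub_one_lt`) gives `C`, `E` with `‖C A E - 1‖ < 1`.
Compressing `C`, `E` and cutting down by `p_k` with `k` large brings an element of `I` to distance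
less than 1 from `p_k` in the corner of `p_k`. So `p_k ∈ I`, and `p_k = ∑ s_i p_(k+1) s_i*` leads
down to `1 = p_0 ∈ I` (`le_idealJ_of_ne_top`). For the second claim, the kernel is a closed ideal,
proper because `1 - p_1 ≠ 0`, hence inside `J_N`, where the homomorphism is injective.

Simplicity is proved on the basis vectors. Monomials respect an extra digit 1 placed far above the
digits of an index, up to a shift of its position. So `A e_r ≠ 0` forces `A e_(r+N^M)` to stay away
from 0 for infinitely many `M`, and the isometry with the digits of `r + N^M` as its word compresses
`A* A` almost to the scalar `‖A e_(r+N^M)‖²`. -/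

noncomputable section

namespace CuntzSections

/-! ### Vectors annihilated in the limit by a bounded sequence of linear maps -/

section Vanishing

variable {E F : Type*} [NormedAddCommGroup E] [NormedSpace ℂ E] [NormedAddCommGroup F]
  [NormedSpace ℂ F]

/-- The vectors `x` with `L n x → 0`. -/
def vanishing (L : ℕ → E →ₗ[ℂ] F) : Submodule ℂ E where
  carrier := {x | Tendsto (fun n => L n x) atTop (𝓝 0)}
  zero_mem' := by simp
  add_mem' {x y} hx hy := by
    have h : Tendsto (fun n => L n x + L n y) atTop (𝓝 (0 + 0)) := Tendsto.add hx hy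
    simpa using h
  smul_mem' c x hx := by
    have h : Tendsto (fun n => c • L n x) atTop (𝓝 (c • 0)) := Tendsto.const_smul hx c
    simpa using h

theorem mem_vanishing {L : ℕ → E →ₗ[ℂ] F} {x : E} :
    x ∈ vanishing L ↔ Tendsto (fun n => L n x) atTop (𝓝 0) := Iff.rfl

/-- Reduces limit statements about a closed algebra to its generators: a uniform bound makes the set
of good vectors a closed subspace. -/
theorem isClosed_vanishing {L : ℕ → E →ₗ[ℂ] F} {C : ℝ} (hL : ∀ n x, ‖L n x‖ ≤ C * ‖x‖) :
    IsClosed (vanishing L : Set E) := by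
  have hL' : ∀ n x, ‖L n x‖ ≤ (|C| + 1) * ‖x‖ := fun n x =>
    (hL n x).trans (mul_le_mul_of_nonneg_right (by linarith [le_abs_self C]) (norm_nonneg x))
  refine isClosed_of_closure_subset fun x hx => ?_
  rw [SetLike.mem_coe, mem_vanishing, Metric.tendsto_atTop]
  intro ε hε
  have hD : 0 < |C| + 1 := by positivity
  obtain ⟨y, hy, hxy⟩ := Metric.mem_closure_iff.1 hx (ε / 2 / (|C| + 1)) (by positivity)
  obtain ⟨m, hm⟩ := Metric.tendsto_atTop.1 (mem_vanishing.1 hy) (ε / 2) (half_pos hε)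
  refine ⟨m, fun n hn => ?_⟩
  have h1 := hm n hn
  rw [dist_zero_right] at h1 ⊢
  rw [dist_eq_norm, lt_div_iff₀ hD] at hxy
  have h2 := hL' n (x - y)
  have h3 : L n x = L n (x - y) + L n y := by rw [map_sub, sub_add_cancel]
  have h4 := norm_add_le (L n (x - y)) (L n y)
  rw [h3]
  linarith

end Vanishing

/-! ### The isometries on the standard basis -/

theorem basisVec_apply (k j : ℕ) : basisVec k j = if j = k then 1 else 0 := by
  simp [basisVec, lp.single_apply, Pi.single_apply]

theorem inner_basisVec (k : ℕ) (v : Hilb) : inner ℂ (basisVec k) v = v k := by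
  simp [basisVec, lp.inner_single_left]

theorem inner_basisVec_basisVec (j k : ℕ) :
    inner ℂ (basisVec j) (basisVec k) = if j = k then (1 : ℂ) else 0 := by
  rw [inner_basisVec, basisVec_apply]

theorem norm_basisVec (k : ℕ) : ‖basisVec k‖ = 1 := by
  simp [basisVec]

theorem hasSum_smul_basisVec (v : Hilb) : HasSum (fun k => v k • basisVec k) v := by
  have h := lp.hasSum_single (p := 2) (by norm_num) v
  have hs : ∀ k, v k • basisVec k = lp.single 2 k (v k) := fun k => by
    rw [basisVec, ← lp.single_smul]; simp
  simpa only [hs] using h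

theorem operator_ext {A B : Hilb →L[ℂ] Hilb} (h : ∀ k, A (basisVec k) = B (basisVec k)) :
    A = B := by
  ext1 v
  have hA := (hasSum_smul_basisVec v).mapL A
  have hB := (hasSum_smul_basisVec v).mapL B
  simp only [map_smul, h] at hA hB
  exact hA.unique hB

theorem cuntzS_basisVec (N : ℕ) (i : Fin N) (r : ℕ) :
    cuntzS N i (basisVec r) = basisVec (r * N + i) := by
  ext k
  change spread N i (basisVec r) k = _
  rw [basisVec_apply]
  split_ifs with h
  · rw [h, spread_apply_self, basisVec_apply, if_pos rfl]
  · unfold spread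
    split_ifs with h1
    · rw [basisVec_apply, if_neg]
      rintro rfl
      exact h (by rw [← h1]; exact (Nat.div_add_mod' k N).symm)
    · rfl

theorem star_cuntzS_apply (N : ℕ) (i : Fin N) (v : Hilb) (k : ℕ) :
    star (cuntzS N i) v k = v (k * N + i) := by
  rw [ContinuousLinearMap.star_eq_adjoint, ← inner_basisVec,
    ContinuousLinearMap.adjoint_inner_right, cuntzS_basisVec, inner_basisVec]

theorem star_cuntzS_basisVec (N : ℕ) (i : Fin N) (k : ℕ) :
    star (cuntzS N i) (basisVec k) = if k % N = i then basisVec (k / N) else 0 := by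
  ext j
  rw [star_cuntzS_apply, basisVec_apply]
  have h : j * N + i = k ↔ k % N = i ∧ j = k / N := by
    constructor
    · rintro rfl
      rw [mul_comm, Nat.mul_add_mod, Nat.mod_eq_of_lt i.isLt, Nat.mul_add_div i.pos,
        Nat.div_eq_of_lt i.isLt]
      simp
    · rintro ⟨h1, rfl⟩
      rw [← h1, Nat.div_add_mod']
  simp only [h]
  by_cases h1 : k % N = i
  · simp [h1, basisVec_apply]
  · simp [h1]

theorem norm_cuntzS_le (N : ℕ) (i : Fin N) : ‖cuntzS N i‖ ≤ 1 :=
  LinearIsometry.norm_toContinuousLinearMap_le _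

/-- Products of isometries concatenate digits. This is why `cuntzS (N ^ l) a` can stand for `S_μ`,
with `μ` the word of the `l` base-`N` digits of `a`. -/
theorem cuntzS_mul (L M K : ℕ) (j : Fin L) (i : Fin M) (c : Fin K) (hK : K = M * L)
    (hc : (c : ℕ) = i * L + j) : cuntzS L j * cuntzS M i = cuntzS K c := by
  refine operator_ext fun r => ?_
  rw [mul_apply_eq_comp, cuntzS_basisVec, cuntzS_basisVec, cuntzS_basisVec, hc, hK]
  congr 1
  ring

theorem star_cuntzS_mul (N : ℕ) (i j : Fin N) :
    star (cuntzS N i) * cuntzS N j = if j = i then 1 else 0 := by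
  refine operator_ext fun r => ?_
  rw [mul_apply_eq_comp, cuntzS_basisVec, star_cuntzS_basisVec]
  have h1 : (r * N + j) % N = j := by
    rw [mul_comm, Nat.mul_add_mod, Nat.mod_eq_of_lt j.isLt]
  have h2 : (r * N + j) / N = r := by
    rw [mul_comm, Nat.mul_add_div j.pos, Nat.div_eq_of_lt j.isLt, add_zero]
  rw [h1, h2]
  by_cases h : j = i
  · simp [h]
  · have h' : (j : ℕ) ≠ i := fun h3 => h (Fin.ext h3)
    simp [h, h']

theorem sum_cuntzS_mul_star (N : ℕ) [NeZero N] :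
    ∑ i, cuntzS N i * star (cuntzS N i) = 1 := by
  refine operator_ext fun r => ?_
  rw [sum_apply,
    Finset.sum_eq_single ⟨r % N, Nat.mod_lt _ (NeZero.pos N)⟩]
  · rw [mul_apply_eq_comp, star_cuntzS_basisVec, if_pos rfl, cuntzS_basisVec,
      one_apply_eq_self, Nat.div_add_mod']
  · intro i _ hi
    rw [mul_apply_eq_comp, star_cuntzS_basisVec, if_neg, map_zero]
    exact fun h => hi (Fin.ext h.symm)
  · simp

/-! ### Monomials -/

theorem cuntzS_pow_succ (N l : ℕ) [NeZero N] (a : Fin (N ^ (l + 1))) :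
    ∃ (i : Fin N) (b : Fin (N ^ l)), cuntzS (N ^ (l + 1)) a = cuntzS N i * cuntzS (N ^ l) b := by
  refine ⟨⟨a % N, Nat.mod_lt _ (NeZero.pos N)⟩,
    ⟨a / N, Nat.div_lt_of_lt_mul (by rw [← pow_succ']; exact a.isLt)⟩, ?_⟩
  exact (cuntzS_mul _ _ _ _ _ _ (pow_succ _ _) (Nat.div_add_mod' _ _).symm).symm

theorem cuntzS_pow_zero (N : ℕ) (a : Fin (N ^ 0)) : cuntzS (N ^ 0) a = 1 := by
  refine operator_ext fun r => ?_
  have ha : (a : ℕ) = 0 := by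
    have := a.isLt
    simpa using this
  rw [cuntzS_basisVec, ha]
  simp

theorem cuntzS_pow_mem (N l : ℕ) [NeZero N] (a : Fin (N ^ l)) :
    cuntzS (N ^ l) a ∈ cuntzAlgebra N := by
  induction l with
  | zero => rw [cuntzS_pow_zero]; exact one_mem _
  | succ l ih =>
    obtain ⟨i, b, h⟩ := cuntzS_pow_succ N l a
    rw [h]
    exact mul_mem (cuntzS_mem N i) (ih b)

/-- The operator `S_μ S_ν^*` for words `μ`, `ν` of the lengths `l`, `k`, which are encoded by the
numbers `a` and `b` with these digits. -/
def monomial (N l k : ℕ) (a : Fin (N ^ l)) (b : Fin (N ^ k)) : Hilb →L[ℂ] Hilb :=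
  cuntzS (N ^ l) a * star (cuntzS (N ^ k) b)

theorem monomial_basisVec (N l k : ℕ) (a : Fin (N ^ l)) (b : Fin (N ^ k)) (m : ℕ) :
    monomial N l k a b (basisVec m) =
      if m % N ^ k = b then basisVec (m / N ^ k * N ^ l + a) else 0 := by
  rw [monomial, mul_apply_eq_comp, star_cuntzS_basisVec]
  split_ifs
  · rw [cuntzS_basisVec]
  · rw [map_zero]

/-- The linear span of the monomials. -/
def monomialSpan (N : ℕ) : Submodule ℂ (Hilb →L[ℂ] Hilb) :=
  Submodule.span ℂ {A | ∃ l k a b, A = monomial N l k a b}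

theorem monomial_mem_span (N l k : ℕ) (a : Fin (N ^ l)) (b : Fin (N ^ k)) :
    monomial N l k a b ∈ monomialSpan N :=
  Submodule.subset_span ⟨l, k, a, b, rfl⟩

theorem monomial_mul_cuntzS_mem (N l k : ℕ) [NeZero N] (a : Fin (N ^ l)) (b : Fin (N ^ k))
    (i : Fin N) : monomial N l k a b * cuntzS N i ∈ monomialSpan N := by
  cases k with
  | zero =>
    have hc : (i : ℕ) * N ^ l + a < N ^ (l + 1) := by
      have h1 : ((i : ℕ) + 1) * N ^ l ≤ N * N ^ l := Nat.mul_le_mul_right _ i.isLt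
      have h2 := a.isLt
      rw [pow_succ']
      linarith
    have h : monomial N l 0 a b * cuntzS N i = monomial N (l + 1) 0 ⟨_, hc⟩ b := by
      rw [monomial, monomial, cuntzS_pow_zero, star_one, mul_one, mul_one]
      exact cuntzS_mul _ _ _ _ _ _ (pow_succ' _ _) rfl
    rw [h]
    exact monomial_mem_span _ _ _ _ _
  | succ k =>
    obtain ⟨j, b', h⟩ := cuntzS_pow_succ N k b
    have h' : monomial N l (k + 1) a b * cuntzS N i = if i = j then monomial N l k a b' else 0 := by
      rw [monomial, h, star_mul, mul_assoc, mul_assoc, star_cuntzS_mul]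
      split_ifs
      · rw [mul_one]; rfl
      · simp
    rw [h']
    split_ifs
    · exact monomial_mem_span _ _ _ _ _
    · exact zero_mem _

theorem monomial_mul_star_cuntzS_mem (N l k : ℕ) (a : Fin (N ^ l)) (b : Fin (N ^ k))
    (i : Fin N) : monomial N l k a b * star (cuntzS N i) ∈ monomialSpan N := by
  have hc : (b : ℕ) * N + i < N ^ (k + 1) := by
    have h1 : ((b : ℕ) + 1) * N ≤ N ^ k * N := Nat.mul_le_mul_right _ b.isLt
    have h2 := i.isLt
    rw [pow_succ]
    linarith
  have h : monomial N l k a b * star (cuntzS N i) = monomial N l (k + 1) a ⟨_, hc⟩ := by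
    rw [monomial, monomial, mul_assoc, ← star_mul,
      cuntzS_mul _ _ _ _ _ (⟨_, hc⟩ : Fin (N ^ (k + 1))) (pow_succ _ _) rfl]
  rw [h]
  exact monomial_mem_span _ _ _ _ _

theorem mul_mem_monomialSpan {N : ℕ} {B : Hilb →L[ℂ] Hilb}
    (hB : ∀ l k a b, monomial N l k a b * B ∈ monomialSpan N) {A : Hilb →L[ℂ] Hilb}
    (hA : A ∈ monomialSpan N) : A * B ∈ monomialSpan N := by
  induction hA using Submodule.span_induction with
  | mem x hx => obtain ⟨l, k, a, b, rfl⟩ := hx; exact hB l k a b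
  | zero => rw [zero_mul]; exact zero_mem _
  | add x y _ _ hx hy => rw [add_mul]; exact add_mem hx hy
  | smul c x _ hx => rw [smul_mul_assoc]; exact Submodule.smul_mem _ _ hx

theorem adjoin_le_monomialSpan (N : ℕ) [NeZero N] {A : Hilb →L[ℂ] Hilb}
    (hA : A ∈ StarAlgebra.adjoin ℂ (Set.range (cuntzS N))) : A ∈ monomialSpan N := by
  -- Induction on the right factor, for all left factors at once: only products of a monomial with
  -- one generator are needed, never products of two monomials.
  have key : ∀ B ∈ monomialSpan N, B * A ∈ monomialSpan N := by
    rw [← StarSubalgebra.mem_toSubalgebra, StarAlgebra.adjoin_toSubalgebra] at hA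
    induction hA using Algebra.adjoin_induction with
    | mem x hx =>
      rcases hx with ⟨i, rfl⟩ | ⟨i, hi⟩
      · exact fun B hB => mul_mem_monomialSpan (fun l k a b => monomial_mul_cuntzS_mem N l k a b i) hB
      · obtain rfl : x = star (cuntzS N i) := by rw [hi, star_star]
        exact fun B hB =>
          mul_mem_monomialSpan (fun l k a b => monomial_mul_star_cuntzS_mem N l k a b i) hB
    | algebraMap c =>
      intro B hB
      rw [← Algebra.commutes, ← Algebra.smul_def]
      exact Submodule.smul_mem _ _ hB
    | add x y _ _ hx hy => intro B hB; rw [mul_add]; exact add_mem (hx B hB) (hy B hB)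
    | mul x y _ _ hx hy => intro B hB; rw [← mul_assoc]; exact hy _ (hx B hB)
  have h1 : (1 : Hilb →L[ℂ] Hilb) ∈ monomialSpan N := by
    have h := monomial_mem_span N 0 0 ⟨0, by simp⟩ ⟨0, by simp⟩
    rwa [monomial, cuntzS_pow_zero, star_one, mul_one] at h
  simpa using key 1 h1

/-- A closed subspace that contains all monomials contains the Cuntz algebra. -/
theorem cuntzAlgebra_subset (N : ℕ) [NeZero N] {V : Submodule ℂ (Hilb →L[ℂ] Hilb)}
    (hV : IsClosed (V : Set (Hilb →L[ℂ] Hilb))) (h : ∀ l k a b, monomial N l k a b ∈ V)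
    {A : Hilb →L[ℂ] Hilb} (hA : A ∈ cuntzAlgebra N) : A ∈ V := by
  have h1 : monomialSpan N ≤ V := by
    rw [monomialSpan, Submodule.span_le]
    rintro _ ⟨l, k, a, b, rfl⟩
    exact h l k a b
  have h2 : A ∈ closure (StarAlgebra.adjoin ℂ (Set.range (cuntzS N)) : Set (Hilb →L[ℂ] Hilb)) := by
    rw [← StarSubalgebra.topologicalClosure_coe]
    exact hA
  exact closure_minimal (fun B hB => h1 (adjoin_le_monomialSpan N hB)) hV h2

/-! ### Simplicity of the concrete Cuntz algebra -/

/-- The functional `A ↦ ⟨v, A w⟩`. -/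
def matCoeff (v w : Hilb) : (Hilb →L[ℂ] Hilb) →ₗ[ℂ] ℂ where
  toFun A := inner ℂ v (A w)
  map_add' A B := by simp
  map_smul' c A := by simp

theorem matCoeff_apply (v w : Hilb) (A : Hilb →L[ℂ] Hilb) : matCoeff v w A = inner ℂ v (A w) := rfl

theorem norm_matCoeff_le (v w : Hilb) (A : Hilb →L[ℂ] Hilb) :
    ‖matCoeff v w A‖ ≤ ‖v‖ * (‖A‖ * ‖w‖) :=
  (norm_inner_le_norm _ _).trans (mul_le_mul_of_nonneg_left (A.le_opNorm w) (norm_nonneg v))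

/-- The matrix entry of `A` in row `s` and column `r`. -/
def entry (s r : ℕ) : (Hilb →L[ℂ] Hilb) →ₗ[ℂ] ℂ := matCoeff (basisVec s) (basisVec r)

theorem entry_apply (s r : ℕ) (A : Hilb →L[ℂ] Hilb) : entry s r A = A (basisVec r) s :=
  inner_basisVec _ _

theorem norm_entry_le (s r : ℕ) (A : Hilb →L[ℂ] Hilb) : ‖entry s r A‖ ≤ ‖A‖ := by
  have h := norm_matCoeff_le (basisVec s) (basisVec r) A
  rwa [norm_basisVec, norm_basisVec, mul_one, one_mul] at h

theorem entry_monomial (N l k : ℕ) (a : Fin (N ^ l)) (b : Fin (N ^ k)) (s r : ℕ) :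
    entry s r (monomial N l k a b) =
      if r % N ^ k = b ∧ s = r / N ^ k * N ^ l + a then 1 else 0 := by
  rw [entry_apply, monomial_basisVec]
  by_cases h : r % N ^ k = b
  · simp [h, basisVec_apply]
  · simp [h]

/-- The power is a digit 1 above the lowest `P` digits, which hold `s` and `u`; both the digit's
position and the lower part can be read off. -/
theorem add_pow_eq_add_pow_iff {N : ℕ} (hN : 2 ≤ N) {P s u x y : ℕ} (hs : s < N ^ P)
    (hu : u < N ^ P) : s + N ^ (P + x) = u + N ^ (P + y) ↔ s = u ∧ x = y := by
  have aux : ∀ {s x y : ℕ}, s < N ^ P → x < y → s + N ^ (P + x) < N ^ (P + y) := by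
    intro s x y hs hxy
    have h1 : N ^ P ≤ N ^ (P + x) := Nat.pow_le_pow_right (by omega) (by omega)
    have h2 : N ^ (P + x + 1) ≤ N ^ (P + y) := Nat.pow_le_pow_right (by omega) (by omega)
    have h3 : 2 * N ^ (P + x) ≤ N ^ (P + x + 1) := by
      rw [pow_succ']; exact Nat.mul_le_mul_right _ hN
    omega
  constructor
  · intro h
    rcases lt_trichotomy x y with hxy | rfl | hxy
    · have := aux hs hxy; omega
    · exact ⟨by omega, rfl⟩
    · have := aux hu hxy; omega
  · rintro ⟨rfl, rfl⟩; rfl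

theorem add_pow_mod {N r k P j : ℕ} : (r + N ^ (k + P + j)) % N ^ k = r % N ^ k := by
  rw [add_assoc, pow_add, Nat.add_mul_mod_self_left]

theorem add_pow_div {N r k P j : ℕ} (hN : 2 ≤ N) :
    (r + N ^ (k + P + j)) / N ^ k = r / N ^ k + N ^ (P + j) := by
  rw [add_assoc, pow_add, Nat.add_mul_div_left _ _ (by positivity)]

/-- Adding a high digit to both indices commutes with a monomial up to the shift of the digit. -/
theorem entry_monomial_add_pow {N : ℕ} (hN : 2 ≤ N) (l k : ℕ) (a : Fin (N ^ l)) (b : Fin (N ^ k))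
    (s r : ℕ) {P : ℕ} (hs : s < N ^ P) (hr : r / N ^ k * N ^ l + a < N ^ P) (i j : ℕ) :
    entry (s + N ^ (k + P + i)) (r + N ^ (k + P + j)) (monomial N l k a b) =
      if j + l = i + k then entry s r (monomial N l k a b) else 0 := by
  rw [entry_monomial, entry_monomial, add_pow_mod, add_pow_div hN]
  -- A monomial replaces the last `k` digits by `l` others, so the extra digit moves from position
  -- `k + P + j` to `P + j + l`.
  have h1 : s + N ^ (k + P + i) = (r / N ^ k + N ^ (P + j)) * N ^ l + a ↔
      s = r / N ^ k * N ^ l + a ∧ j + l = i + k := by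
    rw [show (r / N ^ k + N ^ (P + j)) * N ^ l + a = r / N ^ k * N ^ l + a + N ^ (P + (j + l)) by
      rw [← add_assoc, pow_add N (P + j)]; ring, show k + P + i = P + (i + k) by ring,
      add_pow_eq_add_pow_iff hN hs hr, eq_comm (a := i + k)]
  simp only [h1]
  by_cases h2 : j + l = i + k <;> simp [h2]

/-- The vector `e_{r + N^M} + … + e_{r + N^(M + n - 1)}`. -/
def blockVec (N n M r : ℕ) : Hilb := ∑ j ∈ Finset.range n, basisVec (r + N ^ (M + j))

theorem norm_blockVec_le {N : ℕ} (hN : 2 ≤ N) (n M r : ℕ) : ‖blockVec N n M r‖ ≤ √n := by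
  refine Real.le_sqrt_of_sq_le (le_of_eq ?_)
  have h : (inner ℂ (blockVec N n M r) (blockVec N n M r) : ℂ) = n := by
    simp only [blockVec, sum_inner, inner_sum, inner_basisVec_basisVec]
    have h1 : ∀ i j, r + N ^ (M + j) = r + N ^ (M + i) ↔ j = i := fun i j => by
      rw [Nat.add_left_cancel_iff, Nat.pow_right_inj hN, Nat.add_left_cancel_iff]
    simp only [h1, Finset.sum_ite_eq']
    rw [Finset.sum_congr rfl fun i hi => if_pos hi]
    simp
  rw [inner_self_eq_norm_sq_to_K] at h
  exact Complex.ofReal_injective (by simpa using h)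

theorem matCoeff_blockVec (N n M s r : ℕ) (A : Hilb →L[ℂ] Hilb) :
    matCoeff (blockVec N n M s) (blockVec N n M r) A =
      ∑ i ∈ Finset.range n, ∑ j ∈ Finset.range n, entry (s + N ^ (M + i)) (r + N ^ (M + j)) A := by
  simp only [matCoeff_apply, blockVec, map_sum, sum_inner, inner_sum, entry]
  exact Finset.sum_comm

/-- The number of `i, j < n` on a diagonal. -/
def diagCount (n l k : ℕ) : ℕ :=
  ((Finset.range n ×ˢ Finset.range n).filter fun q => q.2 + l = q.1 + k).card

theorem diagCount_le (n l k : ℕ) : diagCount n l k ≤ n := by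
  conv_rhs => rw [← Finset.card_range n]
  refine Finset.card_le_card_of_injOn Prod.fst (fun q hq => ?_) fun q hq q' hq' h => ?_
  · simp only [Finset.coe_filter, Finset.mem_product, Set.mem_ofPred_eq] at hq
    exact hq.1.1
  · simp only [Finset.coe_filter, Finset.mem_product, Set.mem_ofPred_eq] at hq hq'
    exact Prod.ext h (by omega)

theorem le_diagCount (n l k : ℕ) : n ≤ diagCount n l k + (l + k) := by
  rw [← Nat.sub_le_iff_le_add, ← Finset.card_range (n - (l + k))]
  refine Finset.card_le_card_of_injOn (fun t => (t + l, t + k)) (fun t ht => ?_)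
    fun t _ t' _ h => ?_
  · simp only [Finset.coe_range, Set.mem_Iio] at ht
    simp only [Finset.coe_filter, Finset.mem_product, Finset.mem_range, Set.mem_ofPred_eq]
    omega
  · simpa using h

theorem tendsto_diagCount_div (l k : ℕ) :
    Tendsto (fun n : ℕ => (n : ℂ)⁻¹ * diagCount n l k) atTop (𝓝 1) := by
  rw [tendsto_iff_norm_sub_tendsto_zero]
  refine squeeze_zero' (Eventually.of_forall fun n => norm_nonneg _) ?_
    (tendsto_const_div_atTop_nhds_zero_nat ((l + k : ℕ) : ℝ))
  filter_upwards [eventually_gt_atTop 0] with n hn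
  have hn' : (n : ℂ) ≠ 0 := by exact_mod_cast hn.ne'
  have hn'' : (0 : ℝ) < n := by exact_mod_cast hn
  have h1 : (n : ℂ)⁻¹ * diagCount n l k - 1 = ((((diagCount n l k : ℝ) - n) / n : ℝ) : ℂ) := by
    push_cast
    field_simp
  have h2 : (diagCount n l k : ℝ) ≤ n := by exact_mod_cast diagCount_le n l k
  have h3 : (n : ℝ) ≤ diagCount n l k + (l + k : ℕ) := by exact_mod_cast le_diagCount n l k
  rw [h1, Complex.norm_real, Real.norm_eq_abs, abs_div, abs_of_pos hn'']
  refine div_le_div_of_nonneg_right ?_ hn''.le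
  rw [abs_le]
  constructor <;> linarith

/-- The entries of elements of the Cuntz algebra can be recovered from entries with large
indices. -/
theorem tendsto_matCoeff_blockVec {N : ℕ} [NeZero N] (hN : 2 ≤ N) {A : Hilb →L[ℂ] Hilb}
    (hA : A ∈ cuntzAlgebra N) (s r : ℕ) {f : ℕ → ℕ} (hf : Tendsto f atTop atTop) :
    Tendsto (fun n : ℕ => (n : ℂ)⁻¹ * matCoeff (blockVec N n (f n) s) (blockVec N n (f n) r) A)
      atTop (𝓝 (entry s r A)) := by
  -- The block vectors have norm at most `√n`, so these functionals are bounded by 2 uniformly in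
  -- `n`, and it suffices to treat monomials.
  let L : ℕ → (Hilb →L[ℂ] Hilb) →ₗ[ℂ] ℂ := fun n =>
    (n : ℂ)⁻¹ • matCoeff (blockVec N n (f n) s) (blockVec N n (f n) r) - entry s r
  have hL : ∀ n B, ‖L n B‖ ≤ 2 * ‖B‖ := by
    intro n B
    have h1 := norm_entry_le s r B
    have h2 : ‖(n : ℂ)⁻¹ * matCoeff (blockVec N n (f n) s) (blockVec N n (f n) r) B‖ ≤ ‖B‖ := by
      rw [norm_mul, norm_inv, Complex.norm_natCast]
      have h3 := norm_matCoeff_le (blockVec N n (f n) s) (blockVec N n (f n) r) B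
      have h4 : ‖blockVec N n (f n) s‖ * (‖B‖ * ‖blockVec N n (f n) r‖) ≤ √n * (‖B‖ * √n) := by
        gcongr <;> exact norm_blockVec_le hN _ _ _
      have h5 : √(n : ℝ) * (‖B‖ * √n) = n * ‖B‖ := by
        rw [mul_comm ‖B‖, ← mul_assoc, Real.mul_self_sqrt (Nat.cast_nonneg n)]
      rcases Nat.eq_zero_or_pos n with rfl | hn
      · simp
      · have hn' : (0 : ℝ) < n := by exact_mod_cast hn
        rw [inv_mul_le_iff₀ hn']
        linarith
    have h6 := norm_sub_le ((n : ℂ)⁻¹ * matCoeff (blockVec N n (f n) s) (blockVec N n (f n) r) B)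
      (entry s r B)
    change ‖(n : ℂ)⁻¹ * matCoeff (blockVec N n (f n) s) (blockVec N n (f n) r) B - entry s r B‖ ≤ _
    linarith
  have hmem : A ∈ vanishing L := by
    refine cuntzAlgebra_subset N (isClosed_vanishing hL) (fun l k a b => ?_) hA
    rw [mem_vanishing]
    set c := entry s r (monomial N l k a b) with hc
    have h1 : Tendsto (fun n : ℕ => (n : ℂ)⁻¹ * diagCount n l k * c - c) atTop (𝓝 0) := by
      have h := ((tendsto_diagCount_div l k).mul_const c).sub_const c
      simpa using h
    refine h1.congr' ?_
    obtain ⟨P, hP⟩ : ∃ P, s + (r / N ^ k * N ^ l + a) < N ^ P := ⟨_, Nat.lt_pow_self hN⟩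
    filter_upwards [hf.eventually_ge_atTop (k + P)] with n hn
    obtain ⟨d, hd⟩ := Nat.exists_eq_add_of_le hn
    have hP' : N ^ P ≤ N ^ (P + d) := Nat.pow_le_pow_right (by omega) (by omega)
    change _ = (n : ℂ)⁻¹ * matCoeff (blockVec N n (f n) s) (blockVec N n (f n) r) _ - c
    rw [matCoeff_blockVec, hd, add_assoc k P d]
    -- Each term of the double sum is now `c` on one diagonal and 0 elsewhere, so the average is `c`
    -- times `diagCount n l k / n`, which tends to `c`.
    simp only [entry_monomial_add_pow hN l k a b s r (P := P + d) (by omega) (by omega)]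
    rw [← hc, mul_assoc, diagCount, ← Finset.sum_product', ← Finset.sum_filter, Finset.sum_const,
      nsmul_eq_mul]
  have h := (mem_vanishing.1 hmem).add_const (entry s r A)
  simpa [L] using h

/-- Otherwise the blocks could be placed so far out that `A` is small on all their basis vectors.
The averaged coefficients would then tend to 0, although their limits are the entries of `A e_r`. -/
theorem frequently_norm_apply_add_pow {N : ℕ} [NeZero N] (hN : 2 ≤ N) {A : Hilb →L[ℂ] Hilb}
    (hA : A ∈ cuntzAlgebra N) {r : ℕ} (hr : A (basisVec r) ≠ 0) :
    ∃ δ > 0, ∃ᶠ M in atTop, δ ≤ ‖A (basisVec (r + N ^ M))‖ := by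
  by_contra! hcon
  refine hr ?_
  have hsmall : ∀ n : ℕ, ∃ M₀, ∀ M ≥ M₀, ‖A (basisVec (r + N ^ M))‖ < 1 / (n + 1) := fun n => by
    have h := hcon (1 / (n + 1)) (by positivity)
    simpa only [eventually_atTop] using h
  choose g hg using hsmall
  -- The maximum makes `f` diverge and puts the whole block where `‖A e‖ < 1 / (n + 1)`.
  let f : ℕ → ℕ := fun n => max n (g n)
  have hf : Tendsto f atTop atTop := tendsto_atTop_mono (fun n => le_max_left n (g n)) tendsto_id
  ext s
  have h1 := tendsto_matCoeff_blockVec hN hA s r hf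
  have h2 : Tendsto (fun n : ℕ => (n : ℂ)⁻¹ *
      matCoeff (blockVec N n (f n) s) (blockVec N n (f n) r) A) atTop (𝓝 0) := by
    have h3 : Tendsto (fun n : ℕ => √(1 / ((n : ℝ) + 1))) atTop (𝓝 0) := by
      simpa using (tendsto_one_div_add_atTop_nhds_zero_nat (𝕜 := ℝ)).sqrt
    refine squeeze_zero_norm (fun n => ?_) h3
    rcases Nat.eq_zero_or_pos n with rfl | hn
    · simp
    have hn' : (0 : ℝ) < n := by exact_mod_cast hn
    have h4 : ‖A (blockVec N n (f n) r)‖ ≤ n * (1 / (n + 1)) := by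
      rw [blockVec, map_sum]
      refine (norm_sum_le_of_le _ fun j _ =>
        (hg n (f n + j) ((le_max_right _ _).trans (Nat.le_add_right _ _))).le).trans (le_of_eq ?_)
      simp
    rw [norm_mul, norm_inv, Complex.norm_natCast, inv_mul_le_iff₀ hn']
    calc ‖matCoeff (blockVec N n (f n) s) (blockVec N n (f n) r) A‖
        ≤ ‖blockVec N n (f n) s‖ * ‖A (blockVec N n (f n) r)‖ := by
          rw [matCoeff_apply]; exact norm_inner_le_norm _ _
      _ ≤ √((n : ℝ) + 1) * (n * (1 / (n + 1))) := by
          refine mul_le_mul ((norm_blockVec_le hN _ _ _).trans (Real.sqrt_le_sqrt (by linarith))) h4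
            (norm_nonneg _) (Real.sqrt_nonneg _)
      _ = n * √(1 / ((n : ℝ) + 1)) := by
          have h5 : (0 : ℝ) < n + 1 := by positivity
          rw [Real.sqrt_div zero_le_one, Real.sqrt_one]
          have h6 : √((n : ℝ) + 1) ≠ 0 := (Real.sqrt_pos.2 h5).ne'
          field_simp
          rw [Real.sq_sqrt h5.le]
  rw [← entry_apply, tendsto_nhds_unique h1 h2]
  simp

/-! ### Compression to scalars by isometries of long words -/

theorem norm_star_mul_mul_le {T B : Hilb →L[ℂ] Hilb} (hT : ‖T‖ ≤ 1) : ‖star T * B * T‖ ≤ ‖B‖ := by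
  have h1 : ‖star T * B * T‖ ≤ ‖star T‖ * ‖B‖ * ‖T‖ :=
    (norm_mul_le _ _).trans (mul_le_mul_of_nonneg_right (norm_mul_le _ _) (norm_nonneg _))
  have hs : ‖star T‖ = ‖T‖ := by
    rw [ContinuousLinearMap.star_eq_adjoint]
    exact LinearIsometryEquiv.norm_map _ _
  rw [hs] at h1
  refine h1.trans ?_
  have h2 : ‖T‖ * ‖B‖ ≤ ‖B‖ := mul_le_of_le_one_left (norm_nonneg _) hT
  exact (mul_le_of_le_one_right (by positivity) hT).trans h2

/-- The isometry `S_μ`, where `μ` consists of the `M + 1` last digits of `r + N ^ M`. -/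
def wordIsometry (N : ℕ) [NeZero N] (r M : ℕ) : Hilb →L[ℂ] Hilb :=
  cuntzS (N ^ (M + 1)) ⟨(r + N ^ M) % N ^ (M + 1), Nat.mod_lt _ (pow_pos (NeZero.pos N) _)⟩

theorem wordIsometry_mem (N : ℕ) [NeZero N] (r M : ℕ) : wordIsometry N r M ∈ cuntzAlgebra N :=
  cuntzS_pow_mem _ _ _

theorem norm_wordIsometry_le (N : ℕ) [NeZero N] (r M : ℕ) : ‖wordIsometry N r M‖ ≤ 1 :=
  norm_cuntzS_le _ _

/-- If `l ≠ k`, the monomial moves the digit 1 of the word to another position, so its image has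
orthogonal range and the product vanishes; if `l = k`, the low digits decide. The digit 1 is
essential: a word of zeros would compress `S_0` to `S_0`, which is no scalar. -/
theorem star_mul_monomial_mul {N : ℕ} [NeZero N] (hN : 2 ≤ N) (l k : ℕ) (a : Fin (N ^ l))
    (b : Fin (N ^ k)) {r P : ℕ} (hr : r < N ^ P) (hu : r / N ^ k * N ^ l + a < N ^ P) :
    star (wordIsometry N r (k + P)) * monomial N l k a b * wordIsometry N r (k + P) =
      entry (r + N ^ (k + P)) (r + N ^ (k + P)) (monomial N l k a b) • 1 := by
  have hent := entry_monomial_add_pow hN l k a b r r hr hu 0 0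
  rw [add_zero, zero_add, zero_add] at hent
  set u := r / N ^ k * N ^ l + a with hu_def
  have hpk : N ^ P ≤ N ^ (k + P) := Nat.pow_le_pow_right (by omega) (by omega)
  have hlt : ∀ {v Q : ℕ}, v < N ^ P → P ≤ Q → v + N ^ Q < N ^ (Q + 1) := by
    intro v Q hv hQ
    have h1 : N ^ P ≤ N ^ Q := Nat.pow_le_pow_right (by omega) hQ
    have h2 : 2 * N ^ Q ≤ N ^ (Q + 1) := by rw [pow_succ']; exact Nat.mul_le_mul_right _ hN
    omega
  -- The reduction in `wordIsometry` only makes the index admissible; it does nothing here.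
  have hmod : (r + N ^ (k + P)) % N ^ (k + P + 1) = r + N ^ (k + P) :=
    Nat.mod_eq_of_lt (hlt hr (by omega))
  refine operator_ext fun x => ?_
  rw [hent, mul_apply_eq_comp, mul_apply_eq_comp]
  simp only [wordIsometry, hmod]
  rw [cuntzS_basisVec, monomial_basisVec, entry_monomial]
  simp only [← hu_def]
  have h1 : (x * N ^ (k + P + 1) + (r + N ^ (k + P))) % N ^ k = r % N ^ k := by
    rw [show x * N ^ (k + P + 1) + (r + N ^ (k + P)) = r + N ^ k * (x * N ^ (P + 1) + N ^ P) by
      rw [pow_succ, pow_add]; ring, Nat.add_mul_mod_self_left]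
  have h2 : (x * N ^ (k + P + 1) + (r + N ^ (k + P))) / N ^ k * N ^ l + a =
      x * N ^ (P + l + 1) + (u + N ^ (P + l)) := by
    rw [show x * N ^ (k + P + 1) + (r + N ^ (k + P)) = r + N ^ k * (x * N ^ (P + 1) + N ^ P) by
      rw [pow_succ, pow_add]; ring, Nat.add_mul_div_left _ _ (by positivity), hu_def]
    rw [pow_succ, pow_add, pow_succ]; ring
  rw [h1, h2]
  by_cases hb : r % N ^ k = b
  swap
  · simp [hb]
  rw [if_pos hb, star_cuntzS_basisVec]
  simp only [hb, true_and]
  have key : (x * N ^ (P + l + 1) + (u + N ^ (P + l))) % N ^ (k + P + 1) = r + N ^ (k + P) ↔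
      l = k ∧ r = u := by
    rcases lt_trichotomy l k with hlk | rfl | hlk
    -- Modulo `N ^ (P + l + 1)` the left side still has the digit 1 at position `P + l`, while the
    -- right side is just `r < N ^ P`.
    · refine iff_of_false (fun h => ?_) (fun h => hlk.ne h.1)
      have hd : N ^ (P + l + 1) ∣ N ^ (k + P + 1) := pow_dvd_pow _ (by omega)
      have h3 := congrArg (· % N ^ (P + l + 1)) h
      simp only [Nat.mod_mod_of_dvd _ hd] at h3
      obtain ⟨c, hc⟩ : N ^ (P + l + 1) ∣ N ^ (k + P) := pow_dvd_pow _ (by omega)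
      have h4 : N ^ P ≤ N ^ (P + l) := Nat.pow_le_pow_right (by omega) (by omega)
      have h5 := hlt hu (Q := P + l) (by omega)
      rw [hc, Nat.add_mul_mod_self_left, mul_comm x, Nat.mul_add_mod, Nat.mod_eq_of_lt h5,
        Nat.mod_eq_of_lt (by omega)] at h3
      omega
    · have h5 := hlt hu (Q := P + l) (by omega)
      rw [add_comm l P, mul_comm x, Nat.mul_add_mod, Nat.mod_eq_of_lt h5]
      constructor
      · intro h; exact ⟨rfl, by omega⟩
      · rintro ⟨-, h⟩; rw [h]
    -- Now the digit 1 on the left has moved beyond the modulus and leaves `u < N ^ P`, too small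
    -- for the right side.
    · refine iff_of_false (fun h => ?_) (fun h => hlk.ne' h.1)
      obtain ⟨c, hc⟩ : N ^ (k + P + 1) ∣ N ^ (P + l) := pow_dvd_pow _ (by omega)
      obtain ⟨c', hc'⟩ : N ^ (k + P + 1) ∣ N ^ (P + l + 1) := pow_dvd_pow _ (by omega)
      have h6 : N ^ (k + P) ≤ N ^ (k + P + 1) := Nat.pow_le_pow_right (by omega) (by omega)
      rw [hc, hc', show x * (N ^ (k + P + 1) * c') + (u + N ^ (k + P + 1) * c) =
        u + N ^ (k + P + 1) * (x * c' + c) by ring, Nat.add_mul_mod_self_left,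
        Nat.mod_eq_of_lt (by omega)] at h
      omega
  simp only [key]
  by_cases hlk : l = k ∧ r = u
  · obtain ⟨rfl, hru⟩ := hlk
    have h5 := hlt hu (Q := P + l) (by omega)
    have h7 : (x * N ^ (P + l + 1) + (u + N ^ (P + l))) / N ^ (l + P + 1) = x := by
      rw [add_comm l P, mul_comm x, Nat.mul_add_div (by positivity), Nat.div_eq_of_lt h5, add_zero]
    rw [h7]
    simp [hru]
  · rw [if_neg hlk]
    by_cases h : l = k
    · have h' : ¬ r = u := fun h' => hlk ⟨h, h'⟩
      simp [h, h']
    · simp [h]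

theorem tendsto_star_wordIsometry_mul {N : ℕ} [NeZero N] (hN : 2 ≤ N) {B : Hilb →L[ℂ] Hilb}
    (hB : B ∈ cuntzAlgebra N) (r : ℕ) :
    Tendsto (fun M => star (wordIsometry N r M) * B * wordIsometry N r M -
      entry (r + N ^ M) (r + N ^ M) B • (1 : Hilb →L[ℂ] Hilb)) atTop (𝓝 0) := by
  let L : ℕ → (Hilb →L[ℂ] Hilb) →ₗ[ℂ] (Hilb →L[ℂ] Hilb) := fun M =>
    { toFun := fun B => star (wordIsometry N r M) * B * wordIsometry N r M -
        entry (r + N ^ M) (r + N ^ M) B • (1 : Hilb →L[ℂ] Hilb)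
      map_add' := fun x y => by
        rw [map_add, mul_add, add_mul, add_smul]; abel
      map_smul' := fun c x => by
        rw [map_smul, mul_smul_comm, smul_mul_assoc, smul_assoc, smul_sub, RingHom.id_apply] }
  have hL : ∀ M C, ‖L M C‖ ≤ 2 * ‖C‖ := by
    intro M C
    have h1 := norm_star_mul_mul_le (B := C) (norm_wordIsometry_le N r M)
    have h2 : ‖entry (r + N ^ M) (r + N ^ M) C • (1 : Hilb →L[ℂ] Hilb)‖ ≤ ‖C‖ := by
      rw [norm_smul]
      exact (mul_le_of_le_one_right (norm_nonneg _) ContinuousLinearMap.norm_id_le).trans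
        (norm_entry_le _ _ _)
    have h3 := norm_sub_le (star (wordIsometry N r M) * C * wordIsometry N r M)
      (entry (r + N ^ M) (r + N ^ M) C • (1 : Hilb →L[ℂ] Hilb))
    change ‖star (wordIsometry N r M) * C * wordIsometry N r M -
      entry (r + N ^ M) (r + N ^ M) C • (1 : Hilb →L[ℂ] Hilb)‖ ≤ _
    linarith
  have hmem : B ∈ vanishing L := by
    refine cuntzAlgebra_subset N (isClosed_vanishing hL) (fun l k a b => ?_) hB
    rw [mem_vanishing]
    obtain ⟨P, hP⟩ : ∃ P, r + (r / N ^ k * N ^ l + a) < N ^ P := ⟨_, Nat.lt_pow_self hN⟩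
    refine tendsto_const_nhds.congr' ?_
    filter_upwards [eventually_ge_atTop (k + P)] with M hM
    obtain ⟨d, rfl⟩ := Nat.exists_eq_add_of_le hM
    have hP' : N ^ P ≤ N ^ (P + d) := Nat.pow_le_pow_right (by omega) (by omega)
    rw [add_assoc]
    exact (sub_eq_zero.2 (star_mul_monomial_mul hN l k a b (by omega) (by omega))).symm
  exact mem_vanishing.1 hmem

/-- The Cuntz algebra is simple. -/
theorem exists_norm_mul_mul_sub_one_lt {N : ℕ} [NeZero N] (hN : 2 ≤ N) {A : Hilb →L[ℂ] Hilb}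
    (hA : A ∈ cuntzAlgebra N) (h0 : A ≠ 0) :
    ∃ C ∈ cuntzAlgebra N, ∃ E ∈ cuntzAlgebra N, ‖C * A * E - 1‖ < 1 := by
  obtain ⟨r, hr⟩ : ∃ r, A (basisVec r) ≠ 0 := by
    by_contra! h
    exact h0 (operator_ext fun k => by rw [h k, zero_apply])
  obtain ⟨δ, hδ, hfreq⟩ := frequently_norm_apply_add_pow hN hA hr
  have hlim := Metric.tendsto_atTop.1
    (tendsto_star_wordIsometry_mul hN (mul_mem (star_mem hA) hA) r) (δ ^ 2) (by positivity)
  obtain ⟨M₀, hM₀⟩ := hlim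
  obtain ⟨M, hM, hMδ⟩ := (frequently_atTop.1 hfreq) M₀
  have h1 := hM₀ M hM
  rw [dist_zero_right] at h1
  set T := wordIsometry N r M
  set c := entry (r + N ^ M) (r + N ^ M) (star A * A) with hc
  have hcn : δ ^ 2 ≤ ‖c‖ := by
    rw [hc, entry, matCoeff_apply, mul_apply_eq_comp, ContinuousLinearMap.star_eq_adjoint,
      ContinuousLinearMap.adjoint_inner_right, inner_self_eq_norm_sq_to_K]
    simp only [Complex.coe_algebraMap, norm_pow, Complex.norm_real, norm_norm]
    gcongr
  have hc0 : c ≠ 0 := fun h => by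
    rw [h, norm_zero] at hcn
    linarith [pow_pos hδ 2]
  -- As `c` is the diagonal entry `‖A e_(r+N^M)‖² ≥ δ²` of `A* A`, the error below `δ²` becomes less
  -- than 1 after division by `c`.
  refine ⟨c⁻¹ • (star T * star A), ?_, T, wordIsometry_mem N r M, ?_⟩
  · exact SMulMemClass.smul_mem _ (mul_mem (star_mem (wordIsometry_mem N r M)) (star_mem hA))
  · have h2 : c⁻¹ • (star T * star A) * A * T - 1 =
        c⁻¹ • (star T * (star A * A) * T - c • (1 : Hilb →L[ℂ] Hilb)) := by
      rw [smul_sub, smul_smul, inv_mul_cancel₀ hc0, one_smul]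
      simp only [smul_mul_assoc, mul_assoc]
    rw [h2, norm_smul, norm_inv, inv_mul_lt_iff₀ (norm_pos_iff.2 hc0), mul_one]
    exact h1.trans_le hcn

/-! ### Compressions in the quotient algebra -/

theorem toQuot_eq_of_eventually {η : ℕ → ℕ+} {X Y : SubseqAlg η} (h : ∀ᶠ n in atTop, X n = Y n) :
    toQuot η X = toQuot η Y := by
  refine coset_eq_coset_iff.2 (mem_nullIdeal.2 (tendsto_const_nhds.congr' ?_))
  filter_upwards [h] with n hn
  rw [lp.coeFn_sub, Pi.sub_apply, hn, sub_self, norm_zero]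

theorem le_norm_toQuot_mul {η : ℕ → ℕ+} {X : SubseqAlg η} {c d : ℝ} (hd : 0 ≤ d)
    (h : ∀ᶠ n in atTop, c ≤ ‖X n‖ * d) : c ≤ ‖toQuot η X‖ * d := by
  have key : ∀ ε > (0 : ℝ), c ≤ (‖toQuot η X‖ + ε) * d := by
    intro ε hε
    obtain ⟨Y, hY, hYn⟩ := exists_coset_norm_lt (toQuot η X) hε
    have hXY : X - Y ∈ nullIdeal η := coset_eq_coset_iff.1 hY.symm
    have hlim : Tendsto (fun n => (‖Y‖ + ‖(X - Y) n‖) * d) atTop (𝓝 ((‖Y‖ + 0) * d)) :=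
      ((mem_nullIdeal.1 hXY).const_add _).mul_const _
    rw [add_zero] at hlim
    refine le_trans (ge_of_tendsto hlim ?_) (mul_le_mul_of_nonneg_right hYn.le hd)
    filter_upwards [h] with n hn
    refine hn.trans (mul_le_mul_of_nonneg_right ?_ hd)
    have h1 : X n = Y n + (X - Y) n := by rw [lp.coeFn_sub, Pi.sub_apply, add_sub_cancel]
    rw [h1]
    exact (norm_add_le _ _).trans
      (add_le_add_left (lp.norm_apply_le_norm ENNReal.top_ne_zero Y n) _)
  have hlim : Tendsto (fun ε : ℝ => (‖toQuot η X‖ + ε) * d) (𝓝[>] 0) (𝓝 (‖toQuot η X‖ * d)) := by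
    have hc : Continuous (fun ε : ℝ => (‖toQuot η X‖ + ε) * d) := by fun_prop
    simpa using (hc.tendsto 0).mono_left nhdsWithin_le_nhds
  exact ge_of_tendsto hlim (eventually_nhdsWithin_of_forall key)

theorem norm_toQuot_restrict_le {η : ℕ → ℕ+} (X : SeqAlg) : ‖toQuot η (restrict η X)‖ ≤ ‖X‖ :=
  (norm_coset_le _).trans (lp.norm_le_of_forall_le (norm_nonneg _) fun n =>
    lp.norm_apply_le_norm ENNReal.top_ne_zero X (η n))

theorem continuous_toQuot_restrict (η : ℕ → ℕ+) :
    Continuous ((toQuot η).comp (restrict η)) :=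
  AddMonoidHomClass.continuous_of_bound _ 1 fun X => by
    rw [one_mul]; exact norm_toQuot_restrict_le X

theorem norm_discretize_le (A : Hilb →L[ℂ] Hilb) : ‖discretize A‖ ≤ ‖A‖ :=
  lp.norm_le_of_forall_le (norm_nonneg _) fun n => norm_finiteSection_le A n

theorem finiteSection_cuntzS_apply (N : ℕ) (i : Fin N) (n : ℕ+) (j r : Fin n) :
    finiteSection (cuntzS N i) n j r = if (j : ℕ) = r * N + i then 1 else 0 := by
  change cuntzS N i (basisVec r) j = _
  rw [cuntzS_basisVec, basisVec_apply]

/-! ### The compression map and the projections `p_k` -/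

variable (N : ℕ) [NeZero N]

/-- The coset of the sequence of the finite sections of `A` of the sizes `N ^ n`. -/
def compress : (Hilb →L[ℂ] Hilb) →L[ℂ] QuotAlg (powSeq N) :=
  LinearMap.mkContinuous
    { toFun := fun A => toQuot (powSeq N) (restrict (powSeq N) (discretize A))
      map_add' := fun A B => by
        rw [← map_add, ← map_add]
        rfl
      map_smul' := fun c A => by
        rw [RingHom.id_apply, ← map_smul, ← map_smul]
        rfl } 1 fun A => by
    rw [one_mul]
    exact (norm_toQuot_restrict_le _).trans (norm_discretize_le A)

theorem compress_apply (A : Hilb →L[ℂ] Hilb) :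
    compress N A = toQuot (powSeq N) (restrict (powSeq N) (discretize A)) := rfl

theorem norm_compress_le (A : Hilb →L[ℂ] Hilb) : ‖compress N A‖ ≤ ‖A‖ :=
  (norm_toQuot_restrict_le _).trans (norm_discretize_le A)

theorem discretize_one : discretize 1 = 1 := by
  refine lp.ext (funext fun n => Matrix.ext fun j k => ?_)
  change basisVec k j = (1 : Mat n) j k
  rw [basisVec_apply, Matrix.one_apply]
  simp [Fin.ext_iff]

theorem compress_one : compress N 1 = 1 := by
  rw [compress_apply, discretize_one, map_one, map_one]

theorem discretize_star (A : Hilb →L[ℂ] Hilb) : discretize (star A) = star (discretize A) := by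
  refine lp.ext (funext fun n => Matrix.ext fun j k => ?_)
  change star A (basisVec k) j = star (A (basisVec j) k)
  rw [← inner_basisVec, ← inner_basisVec, ContinuousLinearMap.star_eq_adjoint,
    ContinuousLinearMap.adjoint_inner_right]
  exact (inner_conj_symm _ _).symm

theorem compress_star (A : Hilb →L[ℂ] Hilb) : compress N (star A) = star (compress N A) := by
  rw [compress_apply, discretize_star, map_star, map_star]; rfl

theorem finiteSection_mul_apply {A B : Hilb →L[ℂ] Hilb} {n : ℕ+} (j k : Fin n)
    (h : ∀ l : ℕ, n ≤ l → B (basisVec k) l = 0) :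
    (finiteSection A n * finiteSection B n) j k = finiteSection (A * B) n j k := by
  have h1 : B (basisVec k) = ∑ l ∈ Finset.range n, B (basisVec k) l • basisVec l := by
    refine (hasSum_smul_basisVec (B (basisVec k))).unique (hasSum_sum_of_ne_finset_zero ?_)
    intro l hl
    rw [h l (by simpa using hl), zero_smul]
  change _ = A (B (basisVec k)) j
  rw [h1, map_sum, lp.coeFn_sum, Finset.sum_apply, Finset.sum_range, Matrix.mul_apply]
  refine Finset.sum_congr rfl fun l _ => ?_
  rw [map_smul, lp.coeFn_smul, Pi.smul_apply, smul_eq_mul, mul_comm]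
  rfl

/-- The sequence of the projections `P_{N^(n - k)}`. -/
def levelSeq (k : ℕ) : SubseqAlg (powSeq N) :=
  -- The product form of the condition avoids the subtraction `n - k`.
  ⟨fun n => Matrix.diagonal fun j : Fin (powSeq N n) => if (j : ℕ) * N ^ k < N ^ n then 1 else 0,
    memℓp_infty ⟨1, by
      rintro _ ⟨n, rfl⟩
      dsimp only
      rw [Matrix.l2_opNorm_diagonal, pi_norm_le_iff_of_nonneg zero_le_one]
      intro j
      split_ifs <;> simp⟩⟩

theorem levelSeq_apply (k n : ℕ) : levelSeq N k n =
    Matrix.diagonal fun j : Fin (powSeq N n) => if (j : ℕ) * N ^ k < N ^ n then 1 else 0 := rfl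

/-- The coset `p_k` of the sequence of the projections `P_{N^(n - k)}`. -/
def levelProj (k : ℕ) : QuotAlg (powSeq N) := toQuot (powSeq N) (levelSeq N k)

theorem norm_levelProj_le (k : ℕ) : ‖levelProj N k‖ ≤ 1 := by
  refine (norm_coset_le _).trans (lp.norm_le_of_forall_le zero_le_one fun n => ?_)
  rw [levelSeq_apply, Matrix.l2_opNorm_diagonal, pi_norm_le_iff_of_nonneg zero_le_one]
  intro j
  split_ifs <;> simp

theorem star_levelProj (k : ℕ) : star (levelProj N k) = levelProj N k := by
  rw [levelProj, ← map_star]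
  congr 1
  refine lp.ext (funext fun n => ?_)
  change star (levelSeq N k n) = levelSeq N k n
  rw [levelSeq_apply, Matrix.star_eq_conjTranspose, Matrix.diagonal_conjTranspose]
  congr 1
  ext j
  simp only [Pi.star_apply]
  split_ifs <;> simp

theorem levelProj_mul_of_le {j k : ℕ} (h : j ≤ k) :
    levelProj N j * levelProj N k = levelProj N k := by
  rw [levelProj, levelProj, ← map_mul]
  congr 1
  refine lp.ext (funext fun n => ?_)
  change levelSeq N j n * levelSeq N k n = levelSeq N k n
  rw [levelSeq_apply, levelSeq_apply, Matrix.diagonal_mul_diagonal]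
  congr 1
  ext i
  by_cases hk : (i : ℕ) * N ^ k < N ^ n
  · have hj : (i : ℕ) * N ^ j < N ^ n :=
      (Nat.mul_le_mul_left _ (Nat.pow_le_pow_right (NeZero.pos N) h)).trans_lt hk
    simp [hk, hj]
  · simp [hk]

theorem levelProj_zero : levelProj N 0 = 1 := by
  rw [levelProj, ← map_one (toQuot (powSeq N))]
  congr 1
  refine lp.ext (funext fun n => ?_)
  change levelSeq N 0 n = 1
  rw [levelSeq_apply, ← Matrix.diagonal_one]
  congr 1
  ext i
  rw [pow_zero, mul_one]
  exact if_pos i.isLt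

theorem mul_add_lt_pow_succ_iff {N r i d : ℕ} (hi : i < N) :
    r * N + i < N ^ (d + 1) ↔ r < N ^ d := by
  rw [pow_succ, ← Nat.div_lt_iff_lt_mul (by omega), mul_comm, Nat.mul_add_div (by omega),
    Nat.div_eq_of_lt hi, add_zero]

/-- By `r ↦ rN + i`, the indices below `N ^ d` are exactly those sent below `N ^ (d + 1)`. The
finitely many `n ≤ k` do not affect the coset. -/
theorem compress_cuntzS_mul_levelProj (i : Fin N) (k : ℕ) :
    compress N (cuntzS N i) * levelProj N (k + 1) = levelProj N k * compress N (cuntzS N i) := by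
  rw [compress_apply, levelProj, levelProj, ← map_mul, ← map_mul]
  refine toQuot_eq_of_eventually ?_
  filter_upwards [eventually_ge_atTop (k + 1)] with n hn
  obtain ⟨d, rfl⟩ := Nat.exists_eq_add_of_le hn
  change finiteSection (cuntzS N i) _ * levelSeq N (k + 1) _ =
    levelSeq N k _ * finiteSection (cuntzS N i) _
  rw [levelSeq_apply, levelSeq_apply]
  ext j r
  rw [Matrix.mul_diagonal, Matrix.diagonal_mul, finiteSection_cuntzS_apply]
  by_cases h : (j : ℕ) = r * N + i
  · have h1 : (j : ℕ) * N ^ k < N ^ (k + 1 + d) ↔ (r : ℕ) * N ^ (k + 1) < N ^ (k + 1 + d) := by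
      rw [pow_add N (k + 1) d, mul_comm (N ^ (k + 1)) (N ^ d),
        Nat.mul_lt_mul_right (pow_pos (NeZero.pos N) _), ← mul_add_lt_pow_succ_iff i.isLt, ← h,
        pow_succ' N k, ← mul_assoc, ← pow_succ, Nat.mul_lt_mul_right (pow_pos (NeZero.pos N) _)]
    simp only [h1, mul_comm]
  · simp [h]

theorem star_compress_cuntzS_mul_levelProj (i : Fin N) (k : ℕ) :
    star (compress N (cuntzS N i)) * levelProj N k =
      levelProj N (k + 1) * star (compress N (cuntzS N i)) := by
  have h := congrArg star (compress_cuntzS_mul_levelProj N i k)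
  rw [star_mul, star_mul, star_levelProj, star_levelProj] at h
  exact h.symm

/-- Exact, because `S_i*` never raises an index and so the inner truncation is harmless. -/
theorem compress_mul_star_cuntzS (A : Hilb →L[ℂ] Hilb) (i : Fin N) :
    compress N A * compress N (star (cuntzS N i)) = compress N (A * star (cuntzS N i)) := by
  rw [compress_apply, compress_apply, compress_apply, ← map_mul, ← map_mul]
  congr 2
  refine lp.ext (funext fun n => Matrix.ext fun j r => ?_)
  refine finiteSection_mul_apply j r fun l hl => ?_
  rw [star_cuntzS_apply, basisVec_apply, if_neg]
  have h1 := r.isLt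
  have h2 : l * 1 ≤ l * N := Nat.mul_le_mul_left _ (NeZero.pos N)
  omega

/-- `S_i` may push indices beyond `N ^ n`; the factor `p_1` removes precisely the basis vectors for
which this happens. -/
theorem compress_mul_cuntzS_mul_levelProj (A : Hilb →L[ℂ] Hilb) (i : Fin N) :
    compress N A * compress N (cuntzS N i) * levelProj N 1 =
      compress N (A * cuntzS N i) * levelProj N 1 := by
  rw [compress_apply, compress_apply, compress_apply, levelProj, ← map_mul, ← map_mul, ← map_mul]
  refine toQuot_eq_of_eventually ?_
  filter_upwards [eventually_ge_atTop 1] with n hn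
  obtain ⟨d, rfl⟩ := Nat.exists_eq_add_of_le' hn
  change finiteSection A _ * finiteSection (cuntzS N i) _ * levelSeq N 1 _ =
    finiteSection (A * cuntzS N i) _ * levelSeq N 1 _
  rw [levelSeq_apply]
  ext j r
  rw [Matrix.mul_diagonal, Matrix.mul_diagonal]
  by_cases h : (r : ℕ) * N ^ 1 < N ^ (d + 1)
  · rw [finiteSection_mul_apply]
    intro l hl
    rw [cuntzS_basisVec, basisVec_apply, if_neg]
    rintro rfl
    rw [pow_one] at h
    have h1 : (r : ℕ) < N ^ d := (mul_add_lt_pow_succ_iff (NeZero.pos N)).1 (by simpa using h)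
    exact absurd ((mul_add_lt_pow_succ_iff i.isLt).2 h1) (not_lt.2 hl)
  · rw [if_neg h, mul_zero, mul_zero]

theorem star_compress_cuntzS_mul_self (i : Fin N) :
    star (compress N (cuntzS N i)) * compress N (cuntzS N i) = levelProj N 1 := by
  rw [compress_apply, levelProj, ← map_star, ← map_mul]
  refine toQuot_eq_of_eventually ?_
  filter_upwards [eventually_ge_atTop 1] with n hn
  obtain ⟨d, rfl⟩ := Nat.exists_eq_add_of_le' hn
  rw [levelSeq_apply]
  ext j r
  change (star (finiteSection (cuntzS N i) (powSeq N (d + 1))) *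
    finiteSection (cuntzS N i) (powSeq N (d + 1)) : Mat _) j r = _
  rw [Matrix.mul_apply, Matrix.diagonal_apply, pow_one]
  simp only [Matrix.star_apply, finiteSection_cuntzS_apply]
  have hlt : (r : ℕ) * N < N ^ (d + 1) ↔ (r : ℕ) * N + i < N ^ (d + 1) := by
    have h0 := mul_add_lt_pow_succ_iff (r := r) (d := d) (NeZero.pos N)
    rw [add_zero] at h0
    rw [h0, mul_add_lt_pow_succ_iff i.isLt]
  by_cases hjr : j = r
  · subst hjr
    rw [if_pos rfl]
    split_ifs with h
    · rw [Finset.sum_eq_single ⟨(j : ℕ) * N + i, hlt.1 h⟩]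
      · simp
      · intro l _ hl
        rw [if_neg fun h1 => hl (Fin.ext h1), mul_zero]
      · simp
    · refine Finset.sum_eq_zero fun l _ => ?_
      rw [if_neg, mul_zero]
      intro h1
      exact h (hlt.2 (h1 ▸ l.isLt))
  · rw [if_neg hjr]
    refine Finset.sum_eq_zero fun l _ => ?_
    by_cases h1 : (l : ℕ) = j * N + i
    · rw [if_neg (c := (l : ℕ) = r * N + i), mul_zero]
      intro h2
      exact hjr (Fin.ext (spread_injective_index N i (h1.symm.trans h2)))
    · rw [if_neg h1, star_zero, zero_mul]

theorem levelProj_succ (i : Fin N) (k : ℕ) : levelProj N (k + 1) =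
    star (compress N (cuntzS N i)) * levelProj N k * compress N (cuntzS N i) := by
  rw [mul_assoc, ← compress_cuntzS_mul_levelProj, ← mul_assoc, star_compress_cuntzS_mul_self,
    levelProj_mul_of_le N (Nat.le_add_left 1 k)]

/-- Comes from `∑ S_i S_i* = 1`. It lets an ideal containing `p_(k+1)` climb back to `p_k`, and
finally to 1. -/
theorem levelProj_eq_sum (k : ℕ) : levelProj N k =
    ∑ i, compress N (cuntzS N i) * levelProj N (k + 1) * star (compress N (cuntzS N i)) := by
  simp only [compress_cuntzS_mul_levelProj, mul_assoc]
  rw [← Finset.mul_sum]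
  simp only [← compress_star, compress_mul_star_cuntzS]
  rw [← map_sum, sum_cuntzS_mul_star, compress_one, mul_one]

theorem levelProj_one_ne_one (hN : 2 ≤ N) : levelProj N 1 ≠ 1 := by
  intro h
  rw [← map_one (toQuot (powSeq N)), levelProj] at h
  have h1 := coset_eq_coset_iff.1 h.symm
  rw [mem_nullIdeal] at h1
  have h2 : ∀ᶠ n in atTop, (1 : ℝ) ≤ ‖((1 : SubseqAlg (powSeq N)) - levelSeq N 1) n‖ := by
    filter_upwards [eventually_ge_atTop 1] with n hn
    change 1 ≤ ‖(1 : Mat (powSeq N n)) - levelSeq N 1 n‖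
    rw [levelSeq_apply, ← Matrix.diagonal_one, Matrix.diagonal_sub, Matrix.l2_opNorm_diagonal]
    -- The last basis vector lies outside the range of `P_{N^(n-1)}`, so the difference has norm at
    -- least 1.
    have hpos : 2 ≤ N ^ n := hN.trans (Nat.le_self_pow (by omega) N)
    have hlt : N ^ n - 1 < (powSeq N n : ℕ) := Nat.sub_lt (by omega) one_pos
    refine le_trans ?_ (norm_le_pi_norm _ (⟨N ^ n - 1, hlt⟩ : Fin (powSeq N n)))
    have h3 : ¬ (N ^ n - 1) * N < N ^ n := by
      have : (N ^ n - 1) * 2 ≤ (N ^ n - 1) * N := Nat.mul_le_mul_left _ hN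
      omega
    simp [h3]
  have := ge_of_tendsto h1 h2
  linarith

/-- For fixed `k`, the operators `P_{N^n} A P_{N^(n-k)}` converge strongly to `A`, so cutting by
`p_k` loses nothing of the norm. -/
theorem norm_le_norm_compress_mul_levelProj (A : Hilb →L[ℂ] Hilb) (k : ℕ) (hN : 2 ≤ N) :
    ‖A‖ ≤ ‖compress N A * levelProj N k‖ := by
  refine A.opNorm_le_bound (norm_nonneg _) fun v => ?_
  set C := ‖compress N A * levelProj N k‖ with hC
  let w : ℕ → Hilb := fun m => ∑ l ∈ Finset.range m, v l • basisVec l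
  have hw : Tendsto w atTop (𝓝 v) := (hasSum_smul_basisVec v).tendsto_sum_nat
  suffices h : ∀ m, ‖A (w m)‖ ≤ C * ‖v‖ from
    le_of_tendsto (((A.continuous.tendsto v).comp hw).norm) (Eventually.of_forall h)
  intro m
  refine lp.norm_le_of_forall_sum_le (by norm_num) (by positivity) fun t => ?_
  have hmain : √(∑ j ∈ t, ‖A (w m) j‖ ^ 2) ≤ C * ‖v‖ := by
    rw [hC, compress_apply, levelProj, ← map_mul]
    refine le_norm_toQuot_mul (norm_nonneg v) ?_
    have hlarge : Tendsto (fun n => N ^ n) atTop atTop := tendsto_pow_atTop_atTop_of_one_lt hN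
    -- Large `n` makes room for the tested coordinates `t` and puts the support of `w m` inside the
    -- range of the level projection.
    filter_upwards [hlarge.eventually_gt_atTop (t.sup id), hlarge.eventually_ge_atTop (m * N ^ k)]
      with n hn1 hn2
    have hmn : m ≤ N ^ n := (Nat.le_mul_of_pos_right m (pow_pos (NeZero.pos N) k)).trans hn2
    change _ ≤ ‖finiteSection A (powSeq N n) * levelSeq N k n‖ * ‖v‖
    set X := finiteSection A (powSeq N n) * levelSeq N k n with hX
    let x : EuclideanSpace ℂ (Fin (powSeq N n)) :=
      WithLp.toLp 2 fun l => if (l : ℕ) < m then v l else 0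
    have hx : ‖x‖ ≤ ‖v‖ := by
      have h := lp.sum_rpow_le_norm_rpow (p := 2) (by norm_num) v (Finset.range (N ^ n))
      rw [← Real.rpow_le_rpow_iff (norm_nonneg _) (norm_nonneg _) (by norm_num : (0 : ℝ) < 2)]
      simp only [ENNReal.toReal_ofNat] at h
      refine le_trans ?_ h
      rw [Real.rpow_two, EuclideanSpace.norm_sq_eq, Finset.sum_range]
      refine Finset.sum_le_sum fun l _ => ?_
      simp only [x]
      split_ifs
      · exact (Real.rpow_two _).ge
      · simp
    have hXx : ∀ j, X.mulVec x j = A (w m) (j : ℕ) := by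
      intro j
      have h1 : A (w m) = ∑ l ∈ Finset.range (N ^ n), (if l < m then v l else 0) • A (basisVec l) := by
        simp only [w, map_sum, map_smul, ite_smul, zero_smul]
        rw [← Finset.sum_filter]
        refine Finset.sum_congr ?_ fun _ _ => rfl
        ext l
        simp only [Finset.mem_range, Finset.mem_filter]
        omega
      rw [h1, lp.coeFn_sum, Finset.sum_apply, Finset.sum_range, Matrix.mulVec, dotProduct]
      refine Finset.sum_congr rfl fun l _ => ?_
      rw [hX, levelSeq_apply, Matrix.mul_diagonal, lp.coeFn_smul, Pi.smul_apply, smul_eq_mul]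
      simp only [x]
      by_cases hl : (l : ℕ) < m
      · have h2 : (l : ℕ) * N ^ k < N ^ n :=
          (Nat.mul_lt_mul_of_pos_right hl (pow_pos (NeZero.pos N) k)).trans_le hn2
        rw [if_pos hl, if_pos h2, mul_one, mul_comm]
        rfl
      · rw [if_neg hl, mul_zero, zero_mul]
    have h3 := (Matrix.l2_opNorm_mulVec X x).trans
      (mul_le_mul_of_nonneg_left hx (norm_nonneg X))
    refine le_trans ?_ h3
    rw [EuclideanSpace.norm_eq]
    refine Real.sqrt_le_sqrt ?_
    have h4 : ∑ j : Fin (powSeq N n), ‖(WithLp.toLp 2 (X.mulVec x) :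
        EuclideanSpace ℂ (Fin (powSeq N n))) j‖ ^ 2 =
          ∑ j ∈ Finset.range (N ^ n), ‖A (w m) j‖ ^ 2 := by
      rw [Finset.sum_range]
      exact Finset.sum_congr rfl fun j _ => by rw [← hXx]
    refine le_trans ?_ h4.ge
    refine Finset.sum_le_sum_of_subset_of_nonneg (fun j hj => ?_) fun _ _ _ => by positivity
    exact Finset.mem_range.2 ((Finset.le_sup (f := id) hj).trans_lt hn1)
  simp only [ENNReal.toReal_ofNat, Real.rpow_two]
  exact (Real.sqrt_le_left (by positivity)).1 hmain

/-! ### The elements annihilated by the projections `p_k` in the limit -/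

/-- The elements `x` of `F_η / G_η` with `x p_k → 0`. -/
def levelNull : Submodule ℂ (QuotAlg (powSeq N)) :=
  vanishing fun k => LinearMap.mulRight ℂ (levelProj N k)

theorem mem_levelNull {x : QuotAlg (powSeq N)} :
    x ∈ levelNull N ↔ Tendsto (fun k => x * levelProj N k) atTop (𝓝 0) := Iff.rfl

theorem isClosed_levelNull : IsClosed (levelNull N : Set (QuotAlg (powSeq N))) :=
  isClosed_vanishing (C := 1) fun k x => by
    rw [one_mul]
    exact (norm_mul_le x _).trans (mul_le_of_le_one_right (norm_nonneg x) (norm_levelProj_le N k))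

theorem mul_mem_levelNull (a : QuotAlg (powSeq N)) {x : QuotAlg (powSeq N)}
    (hx : x ∈ levelNull N) : a * x ∈ levelNull N := by
  rw [mem_levelNull] at hx ⊢
  simpa only [mul_assoc, mul_zero] using hx.const_mul a

theorem mem_levelNull_of_mul_eq_zero {x : QuotAlg (powSeq N)} {m : ℕ}
    (h : x * levelProj N m = 0) : x ∈ levelNull N := by
  rw [mem_levelNull]
  refine tendsto_const_nhds.congr' ?_
  filter_upwards [eventually_ge_atTop m] with k hk
  rw [← levelProj_mul_of_le N hk, ← mul_assoc, h, zero_mul]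

/-- The algebra of all right multipliers of `levelNull N`. -/
def rightMultipliers : Subalgebra ℂ (QuotAlg (powSeq N)) where
  carrier := {a | ∀ x ∈ levelNull N, x * a ∈ levelNull N}
  mul_mem' {a b} ha hb x hx := by rw [← mul_assoc]; exact hb _ (ha x hx)
  add_mem' {a b} ha hb x hx := by rw [mul_add]; exact add_mem (ha x hx) (hb x hx)
  algebraMap_mem' c x hx := by
    rw [← Algebra.commutes, ← Algebra.smul_def]; exact Submodule.smul_mem _ c hx

theorem mem_rightMultipliers {a : QuotAlg (powSeq N)} :
    a ∈ rightMultipliers N ↔ ∀ x ∈ levelNull N, x * a ∈ levelNull N := Iff.rfl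

theorem isClosed_rightMultipliers : IsClosed (rightMultipliers N : Set (QuotAlg (powSeq N))) := by
  have h : (rightMultipliers N : Set (QuotAlg (powSeq N))) =
      ⋂ x ∈ levelNull N, (fun a => x * a) ⁻¹' (levelNull N) := by
    ext a
    simp [mem_rightMultipliers]
  rw [h]
  exact isClosed_biInter fun x _ => (isClosed_levelNull N).preimage (continuous_const_mul x)

theorem levelNull_le_rightMultipliers {a : QuotAlg (powSeq N)} (ha : a ∈ levelNull N) :
    a ∈ rightMultipliers N := fun x _ => mul_mem_levelNull N x ha

/-- `levelNull` is visibly a left ideal only. Right multiplication by `s_i` or `s_i*` preserves it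
because it merely shifts the level `k` by one. -/
theorem compress_cuntzS_mem_rightMultipliers (i : Fin N) :
    compress N (cuntzS N i) ∈ rightMultipliers N := by
  intro x hx
  rw [mem_levelNull] at hx ⊢
  rw [← tendsto_add_atTop_iff_nat 1]
  have h := hx.mul_const (compress N (cuntzS N i))
  simpa only [zero_mul, mul_assoc, compress_cuntzS_mul_levelProj] using h

theorem star_compress_cuntzS_mem_rightMultipliers (i : Fin N) :
    star (compress N (cuntzS N i)) ∈ rightMultipliers N := by
  intro x hx
  rw [mem_levelNull] at hx ⊢
  have h := (hx.comp (tendsto_add_atTop_nat 1)).mul_const (star (compress N (cuntzS N i)))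
  simpa only [Function.comp_def, zero_mul, mul_assoc, star_compress_cuntzS_mul_levelProj] using h

/-- The operators `B` such that the compression is multiplicative modulo `levelNull N` on the
products with the right factor `B`. -/
def multiplicativeDomain : Subalgebra ℂ (Hilb →L[ℂ] Hilb) where
  carrier := {B | compress N B ∈ rightMultipliers N ∧
    ∀ A, compress N A * compress N B - compress N (A * B) ∈ levelNull N}
  mul_mem' {B C} hB hC := by
    constructor
    · rw [← sub_sub_cancel (compress N B * compress N C) (compress N (B * C))]
      exact sub_mem (mul_mem hB.1 hC.1) (levelNull_le_rightMultipliers N (hC.2 B))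
    · intro A
      -- The first error is multiplied on the right by the compression of `C`; this is why the
      -- definition also requires right multipliers.
      have h : compress N A * compress N (B * C) - compress N (A * (B * C)) =
          (compress N A * compress N B - compress N (A * B)) * compress N C +
          (compress N (A * B) * compress N C - compress N (A * B * C)) -
          compress N A * (compress N B * compress N C - compress N (B * C)) := by
        rw [← mul_assoc A]
        noncomm_ring
      rw [h]
      exact sub_mem (add_mem (hC.1 _ (hB.2 A)) (hC.2 _)) (mul_mem_levelNull N _ (hC.2 B))
  add_mem' {B C} hB hC := by
    constructor
    · rw [map_add]; exact add_mem hB.1 hC.1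
    · intro A
      have h : compress N A * compress N (B + C) - compress N (A * (B + C)) =
          (compress N A * compress N B - compress N (A * B)) +
          (compress N A * compress N C - compress N (A * C)) := by
        rw [mul_add A, map_add, map_add, mul_add]; abel
      rw [h]
      exact add_mem (hB.2 A) (hC.2 A)
  algebraMap_mem' c := by
    rw [Algebra.algebraMap_eq_smul_one]
    constructor
    · rw [map_smul, compress_one]; exact Subalgebra.smul_mem _ (one_mem _) c
    · intro A
      rw [map_smul, compress_one, mul_smul_comm, mul_smul_comm, mul_one, mul_one, map_smul, sub_self]
      exact zero_mem _

theorem isClosed_multiplicativeDomain :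
    IsClosed (multiplicativeDomain N : Set (Hilb →L[ℂ] Hilb)) := by
  have h : (multiplicativeDomain N : Set (Hilb →L[ℂ] Hilb)) =
      compress N ⁻¹' (rightMultipliers N) ∩
        ⋂ A, (fun B => compress N A * compress N B - compress N (A * B)) ⁻¹' (levelNull N) := by
    ext B
    simp only [Set.mem_inter_iff, Set.mem_iInter]
    rfl
  rw [h]
  refine ((isClosed_rightMultipliers N).preimage (compress N).continuous).inter
    (isClosed_iInter fun A => (isClosed_levelNull N).preimage ?_)
  exact ((continuous_const_mul _).comp (compress N).continuous).sub
    ((compress N).continuous.comp (continuous_const_mul A))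

theorem cuntzAlgebra_le_multiplicativeDomain {B : Hilb →L[ℂ] Hilb} (hB : B ∈ cuntzAlgebra N) :
    B ∈ multiplicativeDomain N := by
  have h1 : Algebra.adjoin ℂ (Set.range (cuntzS N) ∪ star (Set.range (cuntzS N))) ≤
      multiplicativeDomain N := by
    refine Algebra.adjoin_le ?_
    rintro x (⟨i, rfl⟩ | ⟨i, hi⟩)
    · refine ⟨compress_cuntzS_mem_rightMultipliers N i, fun A =>
        mem_levelNull_of_mul_eq_zero N (m := 1) ?_⟩
      rw [sub_mul, compress_mul_cuntzS_mul_levelProj, sub_self]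
    · obtain rfl : x = star (cuntzS N i) := by rw [hi, star_star]
      refine ⟨?_, fun A => ?_⟩
      · rw [compress_star]; exact star_compress_cuntzS_mem_rightMultipliers N i
      · rw [compress_mul_star_cuntzS, sub_self]; exact zero_mem _
  have h2 : B ∈ closure (StarAlgebra.adjoin ℂ (Set.range (cuntzS N)) : Set (Hilb →L[ℂ] Hilb)) := by
    rw [← StarSubalgebra.topologicalClosure_coe]
    exact hB
  refine closure_minimal (fun A hA => h1 ?_) (isClosed_multiplicativeDomain N) h2
  rw [← StarAlgebra.adjoin_toSubalgebra]
  exact hA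

/-- Multiplication by `p_k` kills `x` in the limit but keeps `‖A‖`. Thus the operator part of an
element is unique and depends contractively on it. -/
theorem norm_le_norm_compress_add (hN : 2 ≤ N) (A : Hilb →L[ℂ] Hilb) {x : QuotAlg (powSeq N)}
    (hx : x ∈ levelNull N) : ‖A‖ ≤ ‖compress N A + x‖ := by
  have hlim : Tendsto (fun k => ‖compress N A + x‖ + ‖x * levelProj N k‖) atTop
      (𝓝 (‖compress N A + x‖ + 0)) := by
    have h := (mem_levelNull N).1 hx
    exact (tendsto_zero_iff_norm_tendsto_zero.1 h).const_add _
  rw [add_zero] at hlim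
  refine ge_of_tendsto' hlim fun k => (norm_le_norm_compress_mul_levelProj N A k hN).trans ?_
  have h1 : compress N A * levelProj N k =
      (compress N A + x) * levelProj N k - x * levelProj N k := by rw [add_mul, add_sub_cancel_right]
  rw [h1]
  refine (norm_sub_le _ _).trans (add_le_add_left ((norm_mul_le _ _).trans ?_) _)
  exact mul_le_of_le_one_right (norm_nonneg _) (norm_levelProj_le N k)

/-- The elements that are compressions of elements of the Cuntz algebra modulo `levelNull N`. -/
def compressions : Subalgebra ℂ (QuotAlg (powSeq N)) where
  carrier := {x | ∃ A ∈ cuntzAlgebra N, x - compress N A ∈ levelNull N}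
  mul_mem' := by
    rintro x y ⟨A, hA, hx⟩ ⟨B, hB, hy⟩
    refine ⟨A * B, mul_mem hA hB, ?_⟩
    have hB' := cuntzAlgebra_le_multiplicativeDomain N hB
    have h : x * y - compress N (A * B) = x * (y - compress N B) +
        (x - compress N A) * compress N B +
          (compress N A * compress N B - compress N (A * B)) := by
      noncomm_ring
    rw [h]
    exact add_mem (add_mem (mul_mem_levelNull N x hy) (hB'.1 _ hx)) (hB'.2 A)
  add_mem' := by
    rintro x y ⟨A, hA, hx⟩ ⟨B, hB, hy⟩
    refine ⟨A + B, add_mem hA hB, ?_⟩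
    rw [map_add, add_sub_add_comm]
    exact add_mem hx hy
  algebraMap_mem' c := by
    refine ⟨algebraMap ℂ _ c, algebraMap_mem _ c, ?_⟩
    rw [Algebra.algebraMap_eq_smul_one, Algebra.algebraMap_eq_smul_one, map_smul, compress_one,
      sub_self]
    exact zero_mem _

theorem isClosed_compressions (hN : 2 ≤ N) :
    IsClosed (compressions N : Set (QuotAlg (powSeq N))) := by
  refine isClosed_of_closure_subset fun x hx => ?_
  obtain ⟨y, hy, hyx⟩ := mem_closure_iff_seq_limit.1 hx
  choose A hA hyA using hy
  -- Operator parts of a Cauchy sequence are Cauchy, which yields the operator part of the limit.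
  have hdist : ∀ m n, dist (A m) (A n) ≤ dist (y m) (y n) := by
    intro m n
    rw [dist_eq_norm, dist_eq_norm]
    have h := norm_le_norm_compress_add N hN (A m - A n) (sub_mem (hyA m) (hyA n))
    refine h.trans (le_of_eq (congrArg _ ?_))
    rw [map_sub]
    abel
  have hcauchy : CauchySeq A := by
    rw [Metric.cauchySeq_iff]
    intro ε hε
    obtain ⟨n₀, h⟩ := Metric.cauchySeq_iff.1 hyx.cauchySeq ε hε
    exact ⟨n₀, fun m hm n hn => (hdist m n).trans_lt (h m hm n hn)⟩
  obtain ⟨B, hB⟩ := cauchySeq_tendsto_of_complete hcauchy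
  refine ⟨B, (StarSubalgebra.isClosed_topologicalClosure _).mem_of_tendsto hB
    (Eventually.of_forall hA), ?_⟩
  exact (isClosed_levelNull N).mem_of_tendsto
    (hyx.sub (((compress N).continuous.tendsto B).comp hB)) (Eventually.of_forall hyA)

theorem finiteSectionsAlgebra_le_compressions (hN : 2 ≤ N) {x : QuotAlg (powSeq N)}
    (hx : x ∈ finiteSectionsAlgebra N) : x ∈ compressions N := by
  obtain ⟨_, ⟨a, ha, rfl⟩, rfl⟩ := hx
  set ψ := (toQuot (powSeq N)).comp (restrict (powSeq N)) with hψ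
  have hcl : IsClosed (ψ ⁻¹' (compressions N)) :=
    (isClosed_compressions N hN).preimage (continuous_toQuot_restrict _)
  have hgen : ∀ A ∈ cuntzAlgebra N, ψ (discretize A) ∈ compressions N := fun A hA =>
    ⟨A, hA, by
      rw [show ψ (discretize A) = compress N A from rfl, sub_self]
      exact zero_mem _⟩
  have h1 : Algebra.adjoin ℂ (discretize '' (cuntzAlgebra N : Set (Hilb →L[ℂ] Hilb)) ∪
      star (discretize '' (cuntzAlgebra N : Set (Hilb →L[ℂ] Hilb)))) ≤
        (compressions N).comap ψ.toAlgHom := by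
    refine Algebra.adjoin_le ?_
    rintro X (⟨A, hA, rfl⟩ | ⟨A, hA, hAX⟩)
    · exact hgen A hA
    · obtain rfl : X = discretize (star A) := by rw [discretize_star, hAX, star_star]
      exact hgen _ (star_mem hA)
  have h2 : a ∈ closure (StarAlgebra.adjoin ℂ
      (discretize '' (cuntzAlgebra N : Set (Hilb →L[ℂ] Hilb))) : Set SeqAlg) := by
    rw [← StarSubalgebra.topologicalClosure_coe]
    exact ha
  refine closure_minimal (fun b hb => ?_) hcl h2
  have hb' : b ∈ (StarAlgebra.adjoin ℂ
      (discretize '' (cuntzAlgebra N : Set (Hilb →L[ℂ] Hilb)))).toSubalgebra := hb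
  rw [StarAlgebra.adjoin_toSubalgebra] at hb'
  exact h1 hb'

/-! ### Closed ideals of the algebra `S_N` -/

theorem partialIsom_coe (i : Fin N) : (partialIsom N i : QuotAlg (powSeq N)) =
    compress N (cuntzS N i) := rfl

/-- The compression of an element of the Cuntz algebra as an element of `S_N`. -/
def compressMem {A : Hilb →L[ℂ] Hilb} (hA : A ∈ cuntzAlgebra N) : finiteSectionsAlgebra N :=
  ⟨compress N A, ⟨_, ⟨_, discretize_mem hA, rfl⟩, rfl⟩⟩

/-- The projection `p_k` as an element of `S_N`. -/
def levelProjMem : ℕ → finiteSectionsAlgebra N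
  -- The recursion keeps `p_k` inside `S_N` by construction.
  | 0 => 1
  | k + 1 => star (partialIsom N 0) * levelProjMem k * partialIsom N 0

theorem levelProjMem_coe (k : ℕ) : (levelProjMem N k : QuotAlg (powSeq N)) = levelProj N k := by
  induction k with
  | zero => exact (levelProj_zero N).symm
  | succ k ih => rw [levelProj_succ N 0, ← ih]; rfl

theorem initialProj_coe : (initialProj N : QuotAlg (powSeq N)) = levelProj N 1 :=
  star_compress_cuntzS_mul_self N 0

theorem levelProjMem_eq_sum (k : ℕ) : levelProjMem N k =
    ∑ i, partialIsom N i * levelProjMem N (k + 1) * star (partialIsom N i) := by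
  refine Subtype.ext ?_
  rw [AddSubmonoidClass.coe_finsetSum]
  simp only [MulMemClass.coe_mul, levelProjMem_coe, StarMemClass.coe_star, partialIsom_coe]
  exact levelProj_eq_sum N k

variable {N}

theorem one_mem_of_levelProjMem_mem {I : Ideal (finiteSectionsAlgebra N)} [I.IsTwoSided] {k : ℕ}
    (h : levelProjMem N k ∈ I) : (1 : finiteSectionsAlgebra N) ∈ I := by
  induction k with
  | zero => exact h
  | succ k ih =>
    refine ih ?_
    rw [levelProjMem_eq_sum]
    exact Ideal.sum_mem _ fun i _ => I.mul_mem_right _ (I.mul_mem_left _ h)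

theorem one_sub_levelProjMem_mem {I : Ideal (finiteSectionsAlgebra N)} [I.IsTwoSided]
    (h : 1 - initialProj N ∈ I) (k : ℕ) : 1 - levelProjMem N k ∈ I := by
  induction k with
  | zero => rw [levelProjMem, sub_self]; exact zero_mem _
  | succ k ih =>
    have h1 : 1 - levelProjMem N (k + 1) = (1 - initialProj N) +
        star (partialIsom N 0) * (1 - levelProjMem N k) * partialIsom N 0 := by
      rw [levelProjMem, initialProj]
      noncomm_ring
    rw [h1]
    exact add_mem h (I.mul_mem_right _ (I.mul_mem_left _ ih))

/-- Such an `x` is the limit of the elements `x (1 - p_k)`, which lie in every closed ideal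
containing `1 - p_1`. -/
theorem mem_idealJ_of_mem_levelNull {x : finiteSectionsAlgebra N}
    (hx : (x : QuotAlg (powSeq N)) ∈ levelNull N) : x ∈ idealJ N := by
  refine Submodule.mem_sInf.2 ?_
  rintro I ⟨hI2, hIc, hI⟩
  have h1 : Tendsto (fun k => x * (1 - levelProjMem N k)) atTop (𝓝 x) := by
    rw [tendsto_subtype_rng]
    have h := ((mem_levelNull N).1 hx).const_sub (x : QuotAlg (powSeq N))
    rw [sub_zero] at h
    refine h.congr fun k => ?_
    rw [MulMemClass.coe_mul, AddSubgroupClass.coe_sub, OneMemClass.coe_one, levelProjMem_coe,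
      mul_sub, mul_one]
  exact hIc.mem_of_tendsto h1
    (Eventually.of_forall fun k => Submodule.smul_mem I x (one_sub_levelProjMem_mem hI k))

/-- A closed ideal that contains an element of a corner at distance less than one from the unit `p`
of the corner contains `p`. -/
theorem mem_of_norm_sub_lt_one {A : Type*} [NormedRing A] {I : Ideal A} [I.IsTwoSided]
    (hI : IsClosed (I : Set A)) {p z : A} (hp : p * p = p) (hz : z ∈ I) (hpz : p * z = z)
    (h : ‖p - z‖ < 1) : p ∈ I := by
  -- A Neumann series in the corner without inverses. The exponents start at 1, since the zeroth
  -- power is the unit of `A` rather than `p`.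
  have h1 : ∀ n : ℕ, p - (p - z) ^ (n + 1) ∈ I := by
    intro n
    induction n with
    | zero => simpa using hz
    | succ n ih =>
      have h2 : p - (p - z) ^ (n + 1 + 1) = (p - (p - z) ^ (n + 1)) * (p - z) + z := by
        rw [sub_mul, ← pow_succ, mul_sub, hp, hpz]
        abel
      rw [h2]
      exact add_mem (I.mul_mem_right _ ih) hz
  have h2 : Tendsto (fun n : ℕ => p - (p - z) ^ (n + 1)) atTop (𝓝 p) := by
    have h3 := ((tendsto_pow_atTop_nhds_zero_of_norm_lt_one h).comp
      (tendsto_add_atTop_nat 1)).const_sub p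
    rwa [sub_zero] at h3
  exact hI.mem_of_tendsto h2 (Eventually.of_forall h1)

theorem le_idealJ_of_ne_top (hN : 2 ≤ N) {I : Ideal (finiteSectionsAlgebra N)} [I.IsTwoSided]
    (hI : IsClosed (I : Set (finiteSectionsAlgebra N))) (hne : I ≠ ⊤) : I ≤ idealJ N := by
  intro x hxI
  by_contra hxJ
  refine hne ((Ideal.eq_top_iff_one I).2 ?_)
  have hxK : (x : QuotAlg (powSeq N)) ∉ levelNull N := fun h => hxJ (mem_idealJ_of_mem_levelNull h)
  obtain ⟨A, hA, hxA⟩ := finiteSectionsAlgebra_le_compressions N hN x.2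
  have hA0 : A ≠ 0 := by
    rintro rfl
    rw [map_zero, sub_zero] at hxA
    exact hxK hxA
  obtain ⟨C, hC, E, hE, hCE⟩ := exists_norm_mul_mul_sub_one_lt hN hA hA0
  set y : finiteSectionsAlgebra N := compressMem N hC * x * compressMem N hE with hy
  have hyI : y ∈ I := I.mul_mem_right _ (I.mul_mem_left _ hxI)
  have hA' := cuntzAlgebra_le_multiplicativeDomain N hA
  have hE' := cuntzAlgebra_le_multiplicativeDomain N hE
  -- Modulo `levelNull`, `y` is the compression of `C A E`; its distance from 1 is then governed by
  -- `‖C A E - 1‖`.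
  have hκ : (y : QuotAlg (powSeq N)) - 1 - compress N (C * A * E - 1) ∈ levelNull N := by
    have h : (y : QuotAlg (powSeq N)) - 1 - compress N (C * A * E - 1) =
        compress N C * ((x - compress N A) * compress N E) +
        (compress N C * compress N A - compress N (C * A)) * compress N E +
        (compress N (C * A) * compress N E - compress N (C * A * E)) := by
      rw [map_sub, compress_one]
      change compress N C * (x : QuotAlg (powSeq N)) * compress N E - 1 - _ = _
      noncomm_ring
    rw [h]
    exact add_mem (add_mem (mul_mem_levelNull N _ (hE'.1 _ hxA)) (hE'.1 _ (hA'.2 C))) (hE'.2 _)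
  set κ := (y : QuotAlg (powSeq N)) - 1 - compress N (C * A * E - 1) with hκ_def
  have hlim := tendsto_zero_iff_norm_tendsto_zero.1 ((mem_levelNull N).1 hκ)
  -- At this level the remainder `κ p_k` fits into the gap `1 - ‖C A E - 1‖`.
  obtain ⟨k, hk⟩ := (hlim.eventually_lt_const (sub_pos.2 hCE)).exists
  have hidem : levelProjMem N k * levelProjMem N k = levelProjMem N k :=
    Subtype.ext (by
      rw [MulMemClass.coe_mul, levelProjMem_coe]; exact levelProj_mul_of_le N le_rfl)
  refine one_mem_of_levelProjMem_mem (k := k) (mem_of_norm_sub_lt_one hI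
    (z := levelProjMem N k * (y * levelProjMem N k)) hidem
    (I.mul_mem_left _ (I.mul_mem_right _ hyI)) (by rw [← mul_assoc, hidem]) ?_)
  have h1 : ((levelProjMem N k - levelProjMem N k * (y * levelProjMem N k) :
      finiteSectionsAlgebra N) : QuotAlg (powSeq N)) =
      - (levelProj N k * (compress N (C * A * E - 1) * levelProj N k + κ * levelProj N k)) := by
    rw [AddSubgroupClass.coe_sub, MulMemClass.coe_mul, MulMemClass.coe_mul, levelProjMem_coe,
      ← add_mul, hκ_def, add_sub_cancel, sub_mul, one_mul, mul_sub,
      levelProj_mul_of_le N (le_refl k), neg_sub]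
  change ‖((levelProjMem N k - levelProjMem N k * (y * levelProjMem N k) :
      finiteSectionsAlgebra N) : QuotAlg (powSeq N))‖ < 1
  rw [h1, norm_neg]
  have h2 : ‖compress N (C * A * E - 1) * levelProj N k‖ ≤ ‖C * A * E - 1‖ :=
    (norm_mul_le _ _).trans ((mul_le_of_le_one_right (norm_nonneg _) (norm_levelProj_le N k)).trans
      (norm_compress_le N _))
  have h3 : ‖levelProj N k * (compress N (C * A * E - 1) * levelProj N k + κ * levelProj N k)‖ ≤
      ‖compress N (C * A * E - 1) * levelProj N k + κ * levelProj N k‖ :=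
    (norm_mul_le _ _).trans (mul_le_of_le_one_left (norm_nonneg _) (norm_levelProj_le N k))
  have h4 := norm_add_le (compress N (C * A * E - 1) * levelProj N k) (κ * levelProj N k)
  linarith

/-! ### Homomorphisms out of quotients of C⋆-algebras -/

/-- A self-adjoint element of the range of a `*`-homomorphism of C⋆-algebras has a preimage whose
norm is not larger. -/
theorem exists_preimage_norm_le {A B : Type*} [CStarAlgebra A] [CStarAlgebra B] (ψ : A →⋆ₐ[ℂ] B)
    {a : A} (ha : IsSelfAdjoint (ψ a)) : ∃ b, ψ b = ψ a ∧ ‖b‖ ≤ ‖ψ a‖ := by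
  have hψ : Continuous ψ := AddMonoidHomClass.continuous_of_bound ψ 1 fun x => by
    rw [one_mul]; exact NonUnitalStarAlgHom.norm_apply_le ψ x
  have h2 : IsSelfAdjoint (2⁻¹ : ℂ) := by simp [IsSelfAdjoint]
  -- The real part of `a` is a self-adjoint preimage of the same element; clipping it at `±r` bounds
  -- its norm and changes nothing on the spectrum of `ψ a`.
  set c : A := (2⁻¹ : ℂ) • (a + star a) with hc
  have hcs : IsSelfAdjoint c := h2.smul (IsSelfAdjoint.add_star_self a)
  have hψc : ψ c = ψ a := by
    rw [hc, map_smul, map_add, map_star, ha.star_eq, ← two_smul ℂ (ψ a), smul_smul,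
      inv_mul_cancel₀ two_ne_zero, one_smul]
  set r := ‖ψ a‖
  let f : ℝ → ℝ := fun t => max (-r) (min t r)
  have hf : Continuous f := by fun_prop
  refine ⟨cfc f c, ?_, ?_⟩
  · have h1 : ψ (cfc f c) = cfc f (ψ c) :=
      ψ.map_cfc f c hf.continuousOn hψ hcs (hψc ▸ ha)
    rw [h1, hψc]
    conv_rhs => rw [← cfc_id ℝ (ψ a) ha]
    refine cfc_congr fun t ht => ?_
    have h2 : ‖t‖ ≤ r := by
      rcases subsingleton_or_nontrivial B with hB | hB
      · rw [spectrum.of_subsingleton] at ht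
        exact ht.elim
      · exact spectrum.norm_le_norm_of_mem ht
    rw [Real.norm_eq_abs, abs_le] at h2
    simp only [f, id]
    rw [min_eq_left h2.2, max_eq_right h2.1]
  · refine norm_cfc_le (norm_nonneg _) fun t _ => ?_
    have hr : 0 ≤ r := norm_nonneg _
    rw [Real.norm_eq_abs, abs_le]
    exact ⟨le_max_left _ _, max_le (by linarith) (min_le_right _ _)⟩

instance : CStarAlgebra SeqAlg where

variable (N) in
/-- The surjection of the algebra `S(O_N)` of the finite sections method onto `S_N`. -/
def toFiniteSections :
    sectionsAlgebra (cuntzAlgebra N) →⋆ₐ[ℂ] finiteSectionsAlgebra N where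
  toFun a := ⟨toQuot (powSeq N) (restrict (powSeq N) a), ⟨_, ⟨_, a.2, rfl⟩, rfl⟩⟩
  map_one' := Subtype.ext (by simp)
  map_mul' a b := Subtype.ext (by simp)
  map_zero' := Subtype.ext (by simp)
  map_add' a b := Subtype.ext (by simp)
  commutes' c := rfl
  map_star' a := Subtype.ext (by simp [map_star])

/-- `S_N` is given only as an image, with no completeness at hand, so contractivity is pulled back
to the C⋆-algebra `S(O_N)`: self-adjoint elements lift without increase of norm, and the C⋆-identity
covers the rest. -/
theorem norm_map_le {B : Type*} [NonUnitalCStarAlgebra B]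
    (φ : finiteSectionsAlgebra N →⋆ₙₐ[ℂ] B) (x : finiteSectionsAlgebra N) : ‖φ x‖ ≤ ‖x‖ := by
  have : IsClosed (sectionsAlgebra (cuntzAlgebra N) : Set SeqAlg) :=
    StarSubalgebra.isClosed_topologicalClosure _
  let : CStarAlgebra (sectionsAlgebra (cuntzAlgebra N)) := StarSubalgebra.cstarAlgebra _
  have hsa : ∀ y : finiteSectionsAlgebra N, IsSelfAdjoint y → ‖φ y‖ ≤ ‖y‖ := by
    intro y hy
    obtain ⟨_, ⟨a, ha, rfl⟩, hay⟩ := y.2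
    let ψ : sectionsAlgebra (cuntzAlgebra N) →⋆ₐ[ℂ] QuotAlg (powSeq N) :=
      (finiteSectionsAlgebra N).subtype.comp (toFiniteSections N)
    have hψa : ψ ⟨a, ha⟩ = y := hay
    have hys : IsSelfAdjoint (ψ ⟨a, ha⟩) := by
      rw [hψa]; exact congrArg Subtype.val hy
    obtain ⟨b, hb, hbn⟩ := exists_preimage_norm_le ψ hys
    rw [hψa] at hb hbn
    have hby : toFiniteSections N b = y := Subtype.ext hb
    let χ : sectionsAlgebra (cuntzAlgebra N) →⋆ₙₐ[ℂ] B :=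
      φ.comp (toFiniteSections N).toNonUnitalStarAlgHom
    have h := NonUnitalStarAlgHom.norm_apply_le χ b
    have hχ : χ b = φ y := congrArg φ hby
    rw [hχ] at h
    exact h.trans hbn
  have h1 := hsa (star x * x) (IsSelfAdjoint.star_mul_self x)
  rw [map_mul, map_star, CStarRing.norm_star_mul_self, CStarRing.norm_star_mul_self] at h1
  exact le_of_sq_le_sq (by rwa [sq, sq]) (norm_nonneg _)

theorem injective_of_injOn_idealJ (hN : 2 ≤ N) {B : Type*} [NonUnitalCStarAlgebra B]
    (φ : finiteSectionsAlgebra N →⋆ₙₐ[ℂ] B) (h : Set.InjOn φ (idealJ N)) :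
    Function.Injective φ := by
  let I : Ideal (finiteSectionsAlgebra N) :=
    { carrier := {x | φ x = 0}
      zero_mem' := map_zero φ
      add_mem' := fun {x y} hx hy => by
        change φ (x + y) = 0
        rw [map_add, show φ x = 0 from hx, show φ y = 0 from hy, add_zero]
      smul_mem' := fun c x hx => by
        change φ (c * x) = 0
        rw [map_mul, show φ x = 0 from hx, mul_zero] }
  have hmem : ∀ {x}, x ∈ I ↔ φ x = 0 := Iff.rfl
  have : I.IsTwoSided := ⟨fun {x} c hx => by rw [hmem] at hx ⊢; rw [map_mul, hx, zero_mul]⟩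
  have hcont : Continuous φ := AddMonoidHomClass.continuous_of_bound φ 1 fun x => by
    rw [one_mul]; exact norm_map_le φ x
  have hclosed : IsClosed (I : Set (finiteSectionsAlgebra N)) :=
    isClosed_singleton.preimage hcont
  have hJ : 1 - initialProj N ∈ idealJ N := by
    refine Submodule.mem_sInf.2 ?_
    rintro I ⟨-, -, hI⟩
    exact hI
  -- The nonzero element `1 - p_1` of `J_N` cannot be in the kernel.
  have hne : I ≠ ⊤ := by
    intro htop
    have h1 : φ (1 - initialProj N) = φ 0 := by
      rw [map_zero, ← hmem, htop]
      exact Submodule.mem_top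
    have h2 := congrArg Subtype.val (sub_eq_zero.1 (h hJ (zero_mem _) h1))
    rw [initialProj_coe] at h2
    exact levelProj_one_ne_one N hN h2.symm
  have hle := le_idealJ_of_ne_top hN hclosed hne
  refine (injective_iff_map_eq_zero φ).2 fun x hx => ?_
  exact h (hle (hmem.2 hx)) (zero_mem _) (by rw [hx, map_zero])

end CuntzSections

end

theorem theorem93p6 (N : ℕ) [NeZero N] (hN : 2 ≤ N) :
    (∀ I : Ideal (CuntzSections.finiteSectionsAlgebra N), I.IsTwoSided →
      IsClosed (I : Set (CuntzSections.finiteSectionsAlgebra N)) → I ≠ ⊤ →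
        I ≤ CuntzSections.idealJ N) ∧
    (∀ (B : Type*) [NonUnitalCStarAlgebra B]
      (φ : CuntzSections.finiteSectionsAlgebra N →⋆ₙₐ[ℂ] B),
        Set.InjOn φ (CuntzSections.idealJ N) → Function.Injective φ) :=
  ⟨fun _ _ hI hne => CuntzSections.le_idealJ_of_ne_top hN hI hne,
    fun _ _ φ h => CuntzSections.injective_of_injOn_idealJ hN φ h⟩
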